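/- **Setting.** Let $F$ be a field and let $q\in F$, $q\neq 0$, be such that the quantum integers $[n]=q^{-n+1}+q^{-n+3}+\dots+q^{n-1}$ are non-zero for all $n\ge 1$ (for instance $F=\mathbb C(q)$ with $q$ an indeterminate, or $F=\mathbb R$ with $q>0$; $q=1$ is the $\mathrm{SU}(2)$ case). Put $[n]!=[1]\cdots[n]$. Let $V(n)$ be the $(n+1)$-dimensional $U_q(\mathfrak{sl}_2)$-module with basis $v^n,v^{n-2},\dots,v^{-n}$ and action $Kv^m=q^mv^m$, $Ev^m=[\tfrac{n-m}2]v^{m+2}$, $Fv^m=[\tfrac{n+m}2]v^{m-2}$. On tensor products use the coproduct $\Delta(K)=K\otimes K$, $\Delta(E)=E\otimes 1+K\otimes E$, $\Delta(F)=F\otimes K^{-1}+1\otimes F$. For $s\in\{\pm1\}^n$ put $|s|=\sum_i s_i$, $\|s\|_+=\#\{i<j: s_i>s_j\}$, $\|s\|_-=\#\{i<j:s_i<s_j\}$, and define $$T_n:V(1)^{\otimes n}\to V(n),\quad v^{s_1}\otimes\cdots\otimes v^{s_n}\mapsto q^{\|s\|_+}v^{|s|},\qquad T_n^*:V(n)\to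 V(1)^{\otimes n},\quad v^m\mapsto {n\brack \frac{n-m}2}^{-1}\sum_{|s|=m}q^{-\|s\|_-}\,v^{s_1}\otimes\cdots\otimes v^{s_n}.$$ For $0\le k\le n_2$ the cascade operator on $V(n_1)\otimes V(n_2)$ is $$K_{n_1,n_2}(k)=(T_{n_1}\otimes T_{n_2})(T^*_{n_1+k}\otimes T^*_{n_2-k})(T_{n_1+k}\otimes T_{n_2-k})(T^*_{n_1}\otimes T^*_{n_2}),$$ where $V(1)^{\otimes n_1}\otimes V(1)^{\otimes n_2}=V(1)^{\otimes(n_1+k)}\otimes V(1)^{\otimes(n_2-k)}$ in the left-to-right order. A *cap diagram* with $j$ caps and $r$ through lines is a composition $V(1)^{\otimes r}\to V(1)^{\otimes (r+2j)}$ of $j$ maps $1\otimes\cdots\otimes\delta\otimes\cdots\otimes 1$, where $\delta(1)=v^{-1}\otimes v^{1}-q^{-1}v^1\otimes v^{-1}$. The *dual canonical basis* of $V(n_1)\otimes V(n_2)$ is the set of the non-zero vectors $(T_{n_1}\otimes T_{n_2})\,d\big((v^{-1})^{\otimes a}\otimes (v^{1})^{\otimes (r-a)}\big)$, where $d$ is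 a cap diagram from $V(1)^{\otimes r}$ to $V(1)^{\otimes(n_1+n_2)}$ and $0\le a\le r$. For $0\le j\le\min(n_1,n_2)$ let $\mathcal H_j$ be the space of highest weight vectors of weight $n_1+n_2-2j$ (the vectors $w$ in the span of the $v^s\otimes v^t$ with $s+t=n_1+n_2-2j$ such that $Ew=0$), and let the *sector of total spin deviation $j$*, i.e. of total spin $\frac{n_1+n_2-2j}2$, be the span of the vectors $F^iw$, $i\ge0$, $w\in\mathcal H_j$. **Claim.** Let $n_1,n_2\ge0$, $0\le k\le n_2$, and for $0\le j\le\min(n_1,n_2)$ put $$\lambda_j=\frac{[n_1+k-j]!\,[n_1]!\,[n_2-j]!\,[n_2-k]!}{[n_1-j]!\,[n_1+k]!\,[n_2-j-k]!\,[n_2]!}\ \text{ if } n_2-j\ge k,\qquad \lambda_j=0\ \text{ otherwise.}$$ 1. $K_{n_1,n_2}(k)$ is diagonal in the dual canonical basis of highest weight vectors: for every $0\le j\le\min(n_1,n_2)$ there is exactly one dual canonical basis vector $b_j$ in $\mathcal H_j$, it spans $\mathcal H_j$, and $K_{n_1,n_2}(k)\,b_j=\lambda_j b_j$. 2. For every $0\le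 j\le\min(n_1,n_2)$ and every cap diagram $d:V(1)^{\otimes r}\to V(1)^{\otimes(n_1+n_2)}$ with $j$ caps (so that $r=n_1+n_2-2j$), $$K_{n_1,n_2}(k)\,\Phi=\lambda_j\,\Phi,\qquad \Phi=(T_{n_1}\otimes T_{n_2})\,d\,T_r^*:V(r)\to V(n_1)\otimes V(n_2).$$ 3. $V(n_1)\otimes V(n_2)$ is the direct sum of the sectors $0\le j\le \min(n_1,n_2)$, and $K_{n_1,n_2}(k)$ acts on the $j$-th sector as the scalar $\lambda_j$. In particular its eigenvalues are exactly the $\lambda_j$, $0\le j\le\min(n_1,n_2)$. 4. If $n_1\ge n_2$, then $\lambda_j=0$ for exactly $k$ of the indices $j\in\{0,\dots,n_2\}$ ($k$-fold degeneracy at $0$). 5. If $q$ is a positive real number, then $\lambda_j$ is non-increasing in $j$ for $0\le j\le\min(n_1,n_2)$. -/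

import Mathlib

open scoped TensorProduct

noncomputable section

namespace CascadeSpin

section QuantumNumbers

variable {F : Type*} [Field F]

/-- The quantum integer `[n] = q^(-n+1) + q^(-n+3) + ... + q^(n-1)`. -/
def qInt (q : F) (n : ℕ) : F :=
  ∑ i ∈ Finset.range n, q ^ (2 * (i : ℤ) - (n : ℤ) + 1)

/-- The quantum factorial `[n]! = [1] [2] ... [n]`. -/
def qFact (q : F) (n : ℕ) : F :=
  ∏ i ∈ Finset.range n, qInt q (i + 1)

/-- The quantum binomial coefficient, for `a ≤ n`. -/
def qBinom (q : F) (n a : ℕ) : F :=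
  qFact q n / (qFact q a * qFact q (n - a))

/-- The number `λ_j` attached to `K_{n₁,n₂}(k)`. It is used only for `j ≤ n₁` and `k ≤ n₂`, and in
the first branch `j + k ≤ n₂`, so that no subtraction is truncated. -/
def cascadeEigenvalue (q : F) (n₁ n₂ k j : ℕ) : F :=
  if j + k ≤ n₂ then
    (qFact q (n₁ + k - j) * qFact q n₁ * qFact q (n₂ - j) * qFact q (n₂ - k)) /
      (qFact q (n₁ - j) * qFact q (n₁ + k) * qFact q (n₂ - j - k) * qFact q n₂)
  else 0

end QuantumNumbers

section Representations

/-- The space `V(n)`, of dimension `n + 1`. The coordinate with index `a` belongs to the basis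
vector `v^(n - 2a)`, that is, `a` counts the down arrows. -/
abbrev V (F : Type*) (n : ℕ) : Type _ := Fin (n + 1) → F

variable {F : Type*} [Field F]

/-- The vector `v^(n - 2a)` of `V(n)`; it is `0` when `a > n`. -/
def vec (F : Type*) [Field F] (n a : ℕ) : V F n := fun i => if (i : ℕ) = a then 1 else 0

/-- The linear map on `V(n)` with prescribed values on the basis `v^n, v^(n-2), ..., v^(-n)`. -/
def onBasis {W : Type*} [AddCommGroup W] [Module F W] (n : ℕ) (f : ℕ → W) : V F n →ₗ[F] W :=
  (Pi.basisFun F (Fin (n + 1))).constr F (fun a => f a)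

/-- `E v^m = [(n - m)/2] v^(m+2)`, where `m = n - 2a`. -/
def opE (q : F) (n : ℕ) : V F n →ₗ[F] V F n :=
  onBasis n (fun a => qInt q a • vec F n (a - 1))

/-- `F v^m = [(n + m)/2] v^(m-2)`, where `m = n - 2a`. -/
def opF (q : F) (n : ℕ) : V F n →ₗ[F] V F n :=
  onBasis n (fun a => qInt q (n - a) • vec F n (a + 1))

/-- `K v^m = q^m v^m`, where `m = n - 2a`. -/
def opK (q : F) (n : ℕ) : V F n →ₗ[F] V F n :=
  onBasis n (fun a => q ^ ((n : ℤ) - 2 * (a : ℤ)) • vec F n a)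

/-- `K⁻¹ v^m = q^(-m) v^m`, where `m = n - 2a`. -/
def opKinv (q : F) (n : ℕ) : V F n →ₗ[F] V F n :=
  onBasis n (fun a => q ^ (-((n : ℤ) - 2 * (a : ℤ))) • vec F n a)

/-- The space `V(m) ⊗ V(n)`. -/
abbrev VV (F : Type*) [Field F] (m n : ℕ) : Type _ := V F m ⊗[F] V F n

/-- The action of `E` on `V(m) ⊗ V(n)` through `Δ(E) = E ⊗ 1 + K ⊗ E`. -/
def coE (q : F) (m n : ℕ) : VV F m n →ₗ[F] VV F m n :=
  TensorProduct.map (opE q m) LinearMap.id + TensorProduct.map (opK q m) (opE q n)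

/-- The action of `F` on `V(m) ⊗ V(n)` through `Δ(F) = F ⊗ K⁻¹ + 1 ⊗ F`. -/
def coF (q : F) (m n : ℕ) : VV F m n →ₗ[F] VV F m n :=
  TensorProduct.map (opF q m) (opKinv q n) + TensorProduct.map LinearMap.id (opF q n)

/-- The weight space of weight `m + n - 2j`: it is spanned by the `v^s ⊗ v^t` with
`s + t = m + n - 2j`, that is, with `j` down arrows in all. -/
def weightSpace (F : Type*) [Field F] (m n j : ℕ) : Submodule F (VV F m n) :=
  Submodule.span F {x | ∃ a b : ℕ, a ≤ m ∧ b ≤ n ∧ a + b = j ∧ x = vec F m a ⊗ₜ[F] vec F n b}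

/-- The highest weight vectors of weight `m + n - 2j` (with zero). -/
def highestWeightSpace (q : F) (m n j : ℕ) : Submodule F (VV F m n) :=
  LinearMap.ker (coE q m n) ⊓ weightSpace F m n j

/-- The sector of total spin `(m + n - 2j)/2`, that is, of total spin deviation `j`: the
subspace that the highest weight vectors of weight `m + n - 2j` generate. -/
def spinSector (q : F) (m n j : ℕ) : Submodule F (VV F m n) :=
  Submodule.span F {x | ∃ (i : ℕ), ∃ w ∈ highestWeightSpace q m n j, x = ((coF q m n) ^ i) w}

end Representations

section Symmetrizers

/-- The space `V(1)^{⊗ n}`. -/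
abbrev Tens (F : Type*) [Field F] (n : ℕ) : Type _ := ⨂[F]^n (V F 1)

variable {F : Type*} [Field F]

/-- The standard basis of `V(1)^{⊗ n}`, indexed by words: the letter `0` is an up arrow, `v^1`, and
the letter `1` is a down arrow, `v^(-1)`. -/
def tensBasis (F : Type*) [Field F] (n : ℕ) : Module.Basis (Fin n → Fin 2) F (Tens F n) :=
  Basis.piTensorProduct (fun _ : Fin n => Pi.basisFun F (Fin 2))

/-- The number of down arrows of a word. -/
def downs {n : ℕ} (w : Fin n → Fin 2) : ℕ :=
  (Finset.univ.filter (fun i => w i = 1)).card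

/-- `‖w‖₊`, the number of pairs of an up arrow and a down arrow to the right of it. -/
def normPlus {n : ℕ} (w : Fin n → Fin 2) : ℕ :=
  (Finset.univ.filter (fun p : Fin n × Fin n => p.1 < p.2 ∧ w p.1 = 0 ∧ w p.2 = 1)).card

/-- `‖w‖₋`, the number of pairs of a down arrow and an up arrow to the right of it. -/
def normMinus {n : ℕ} (w : Fin n → Fin 2) : ℕ :=
  (Finset.univ.filter (fun p : Fin n × Fin n => p.1 < p.2 ∧ w p.1 = 1 ∧ w p.2 = 0)).card

/-- The projection `T_n : V(1)^{⊗ n} → V(n)`, which sends the word `w` to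
`q^{‖w‖₊} v^{|w|}`. -/
def symT (q : F) (n : ℕ) : Tens F n →ₗ[F] V F n :=
  (tensBasis F n).constr F (fun w => q ^ normPlus w • vec F n (downs w))

/-- The injection `T_n^* : V(n) → V(1)^{⊗ n}`, which sends `v^m` to the sum of the
`q^{-‖w‖₋} w` over the words `w` of weight `m`, divided by a quantum binomial coefficient. The sign
of the exponent is the one for which `T_n^*` commutes with `E`, `F`, `K` and `T_n ∘ T_n^* = 1`. -/
def symTstar (q : F) (n : ℕ) : V F n →ₗ[F] Tens F n :=
  onBasis n (fun a => (qBinom q n a)⁻¹ •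
    ∑ w ∈ Finset.univ.filter (fun w : Fin n → Fin 2 => downs w = a),
      (q ^ normMinus w)⁻¹ • tensBasis F n w)

/-- The identification of `V(1)^{⊗ m} ⊗ V(1)^{⊗ n}` with `V(1)^{⊗ N}`, where `N = m + n`, which
keeps the order of the tensor factors. -/
def join (F : Type*) [Field F] {m n N : ℕ} (h : m + n = N) :
    Tens F m ⊗[F] Tens F n ≃ₗ[F] Tens F N :=
  TensorPower.mulEquiv.trans (TensorPower.cast F (V F 1) h)

/-- `T_m ⊗ T_n : V(1)^{⊗ N} → V(m) ⊗ V(n)`, where `N = m + n`. -/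
def pairT (q : F) {m n N : ℕ} (h : m + n = N) : Tens F N →ₗ[F] VV F m n :=
  TensorProduct.map (symT q m) (symT q n) ∘ₗ (join F h).symm.toLinearMap

/-- `T_m^* ⊗ T_n^* : V(m) ⊗ V(n) → V(1)^{⊗ N}`, where `N = m + n`. -/
def pairTstar (q : F) {m n N : ℕ} (h : m + n = N) : VV F m n →ₗ[F] Tens F N :=
  (join F h).toLinearMap ∘ₗ TensorProduct.map (symTstar q m) (symTstar q n)

/-- `U_{m,n}^{m',n'} = (T_{m'} ⊗ T_{n'}) (T_m^* ⊗ T_n^*)`, where `m + n = m' + n'`. -/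
def opU (q : F) {m n m' n' : ℕ} (h : m' + n' = m + n) : VV F m n →ₗ[F] VV F m' n' :=
  pairT q h ∘ₗ pairTstar q rfl

/-- The cascade operator `K_{m,n}(k) = (U_{m,n}^{m+k,n-k})^* U_{m,n}^{m+k,n-k}`, for `0 ≤ k ≤ n`.
The star reverses the order of composition and exchanges each `T_r` with `T_r^*`, so that
`(U_{m,n}^{m',n'})^* = (T_m ⊗ T_n) (T_{m'}^* ⊗ T_{n'}^*) = U_{m',n'}^{m,n}`. -/
def cascade (q : F) (m n k : ℕ) (hk : k ≤ n) : VV F m n →ₗ[F] VV F m n :=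
  have h : (m + k) + (n - k) = m + n := by omega
  opU q h.symm ∘ₗ opU q h

end Symmetrizers

section DualCanonical

variable {F : Type*} [Field F]

/-- The word of length `L + 2` in which the letters `x`, `y` are put into `w` at the adjacent
positions `i`, `i + 1`. -/
def insertPair {L : ℕ} (i : Fin (L + 1)) (x y : Fin 2) (w : Fin L → Fin 2) : Fin (L + 2) → Fin 2 :=
  Fin.insertNth (α := fun _ => Fin 2) i.succ y (Fin.insertNth (α := fun _ => Fin 2) i x w)

/-- The elementary cap `1^{⊗ i} ⊗ δ ⊗ 1^{⊗ (L - i)} : V(1)^{⊗ L} → V(1)^{⊗ (L + 2)}`, where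
`δ(1) = (down ⊗ up) - q⁻¹ (up ⊗ down)`. -/
def insertCap (q : F) {L : ℕ} (i : Fin (L + 1)) : Tens F L →ₗ[F] Tens F (L + 2) :=
  (tensBasis F L).constr F (fun w =>
    tensBasis F (L + 2) (insertPair i 1 0 w) - q⁻¹ • tensBasis F (L + 2) (insertPair i 0 1 w))

/-- `IsCapDiagram q r k L d` says that `d : V(1)^{⊗ r} → V(1)^{⊗ L}` is the map of a planar cap
diagram with `k` caps and `r = L - 2k` through lines, none of which cross. These are the diagrams
that are built by successive insertion of caps that join two neighbours. -/
inductive IsCapDiagram (q : F) (r : ℕ) : (k L : ℕ) → (Tens F r →ₗ[F] Tens F L) → Prop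
  | nil : IsCapDiagram q r 0 r LinearMap.id
  | cap {k L : ℕ} {d : Tens F r →ₗ[F] Tens F L} (i : Fin (L + 1)) (hd : IsCapDiagram q r k L d) :
      IsCapDiagram q r (k + 1) (L + 2) (insertCap q i ∘ₗ d)

/-- The word of length `r` with `a` down arrows, all to the left of all the up arrows. -/
def sortedWord (r a : ℕ) : Fin r → Fin 2 := fun i => if (i : ℕ) < a then 1 else 0

/-- The dual canonical basis of `V(m) ⊗ V(n)`: the non-zero images under `T_m ⊗ T_n` of the vectors
that the cap diagrams make of the words with all down arrows to the left of all up arrows. -/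
def dualCanonicalBasis (q : F) (m n : ℕ) : Set (VV F m n) :=
  {x | x ≠ 0 ∧ ∃ (r k a : ℕ) (d : Tens F r →ₗ[F] Tens F (m + n)), a ≤ r ∧
    IsCapDiagram q r k (m + n) d ∧ x = pairT q rfl (d (tensBasis F r (sortedWord r a)))}

end DualCanonical

end CascadeSpin

end

/-!
The idea is to describe everything that happens between two symmetrized blocks by a single
map, the middle cap `midCap q m n : V(m) ⊗ V(n) → V(m + 1) ⊗ V(n + 1)`, which joins the two blocks,
and to commute it past the operators `opU` that shift the boundary between the blocks. The index `a`
of `vec F n a` is the number of down arrows, so that `vec F n a` is `v^(n - 2a)`.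

**Cap diagrams.** `T_m` kills a cap between two of its factors (`symT_cap`), and a cap
across the boundary becomes the middle cap (`pairT_insertCap_middle`). So `(T_{n₁} ⊗ T_{n₂}) d` is
either zero or `j` nested caps around the boundary, applied to `T_{n₁ - j} ⊗ T_{n₂ - j}`
(`IsCapDiagram.pairT_eq`). All the non-zero `Φ` with `j` caps are thus the same map, `multiplet`.

**The eigenvalue.** Put `m' = m + k` and `n' = n - k`. Explicit formulas for `opU`, with quantum
binomial coefficients (`opU_right`, `opU_left`), give the commutation relations
`[n + 1] U C = [n' + 1] C U` for `U` from `V(m) ⊗ V(n)` to `V(m') ⊗ V(n')`, and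
`[m' + 1] U C = [m + 1] C U` in the opposite direction, where `C` is the middle cap
(`opU_midCap_right_succ`, `opU_midCap_left`). If the right block of the target is empty, then
`U C = 0` (`opU_midCap_right_zero`). On symmetric tensors the two `U` just move the boundary
(`opU_pairT_symTstar`), because two small symmetrizers are absorbed by a larger one. With `j` nested
caps the scalars multiply to `λ_j`, which is zero as soon as some cap is killed
(`cascade_multiplet`).

**Sectors.** The middle cap commutes with `E` and `F`, and the splitting `V(m + n) → V(m) ⊗ V(n)`
with `F`. Since `E w = 0` is a recursion that determines `w` by one extreme coordinate, the highest
weight vectors of each weight form a line, spanned by the image of `v^m ⊗ v^n` under the nested caps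
(`highestWeightSpace_eq_span`), and the sector is the image of the injective map `multiplet`
(`spinSector_eq_range`). The sectors are independent since the operators with `k = n₂ - j`,
`0 ≤ j ≤ min n₁ n₂`, act on them by a triangular matrix of scalars with non-zero diagonal, and
their dimensions add up to `(n₁ + 1) (n₂ + 1)` (`isInternal_spinSector`).

**The dual canonical basis.** The spanning vector of the highest weight line has non-zero
coordinates at both extreme vectors, all down arrows in the right block and all down arrows in the
left block. A dual canonical basis vector with a down arrow on a through line has a zero at one of them
(`IsCapDiagram.coord_pairT`). So exactly one of these vectors is a highest weight vector of given
weight.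

**Monotonicity.** For real `q > 0` the quantum integers are positive and increasing, and
`λ_{j+1} / λ_j = [n₁ - j] [n₂ - j - k] / ([n₁ + k - j] [n₂ - j])` is at most `1`.
-/

noncomputable section

namespace CascadeSpin

/-! ### Quantum integers and quantum binomial coefficients -/

section QuantumIntegers

variable {F : Type*} [Field F] {q : F}

@[simp] lemma qInt_zero : qInt q 0 = 0 := by simp [qInt]

@[simp] lemma qInt_one : qInt q 1 = 1 := by simp [qInt]

lemma qInt_add' (hq : q ≠ 0) (x y : ℕ) :
    qInt q (x + y) = q ^ (-(y : ℤ)) * qInt q x + q ^ (x : ℤ) * qInt q y := by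
  simp only [qInt, Finset.sum_range_add, Finset.mul_sum, ← zpow_add₀ hq]
  congr 1 <;> refine Finset.sum_congr rfl fun i _ => ?_ <;> congr 1 <;> push_cast <;> ring

lemma qInt_add (hq : q ≠ 0) (x y : ℕ) :
    qInt q (x + y) = q ^ (y : ℤ) * qInt q x + q ^ (-(x : ℤ)) * qInt q y := by
  rw [add_comm x y, qInt_add' hq, add_comm]

@[simp] lemma qFact_zero : qFact q 0 = 1 := by simp [qFact]

lemma qFact_succ (n : ℕ) : qFact q (n + 1) = qFact q n * qInt q (n + 1) := by
  simp [qFact, Finset.prod_range_succ]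

lemma qFact_ne_zero (hn : ∀ n : ℕ, 0 < n → qInt q n ≠ 0) (n : ℕ) : qFact q n ≠ 0 :=
  Finset.prod_ne_zero_iff.2 fun i _ => hn (i + 1) i.succ_pos

/-- The quantum binomial coefficient, extended by `0` to `a > n`, where `qBinom` takes a meaningless
non-zero value. -/
def gauss (q : F) (n a : ℕ) : F := if a ≤ n then qBinom q n a else 0

lemma gauss_of_lt {n a : ℕ} (h : n < a) : gauss q n a = 0 := by
  simp [gauss, Nat.not_le.2 h]

lemma gauss_add (n a : ℕ) : gauss q (a + n) a = qFact q (a + n) / (qFact q a * qFact q n) := by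
  simp [gauss, qBinom]

lemma gauss_ne_zero (hn : ∀ n : ℕ, 0 < n → qInt q n ≠ 0) {n a : ℕ} (h : a ≤ n) :
    gauss q n a ≠ 0 := by
  obtain ⟨c, rfl⟩ := Nat.exists_eq_add_of_le h
  rw [gauss_add]
  exact div_ne_zero (qFact_ne_zero hn _) (mul_ne_zero (qFact_ne_zero hn _) (qFact_ne_zero hn _))

@[simp] lemma gauss_zero_right (hn : ∀ n : ℕ, 0 < n → qInt q n ≠ 0) (n : ℕ) :
    gauss q n 0 = 1 := by
  simp [gauss, qBinom, div_self (qFact_ne_zero hn n)]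

lemma qInt_mul_gauss_succ (hn : ∀ n : ℕ, 0 < n → qInt q n ≠ 0) (n a : ℕ) :
    qInt q (a + 1) * gauss q n (a + 1) = qInt q (n - a) * gauss q n a := by
  rcases lt_trichotomy n a with h | rfl | h
  · rw [gauss_of_lt h, gauss_of_lt (by omega)]; simp
  · rw [gauss_of_lt (Nat.lt_succ_self n)]; simp
  · obtain ⟨c, rfl⟩ := Nat.exists_eq_add_of_lt h
    have h1 := gauss_add (q := q) c (a + 1)
    have h2 := gauss_add (q := q) (c + 1) a
    rw [show a + 1 + c = a + c + 1 by ring] at h1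
    rw [show a + (c + 1) = a + c + 1 by ring] at h2
    rw [h1, h2, show a + c + 1 - a = c + 1 by omega, qFact_succ a, qFact_succ c]
    have := qFact_ne_zero hn a
    have := qFact_ne_zero hn c
    have := hn (a + 1) a.succ_pos
    have := hn (c + 1) c.succ_pos
    field_simp

lemma qInt_mul_gauss_left (hn : ∀ n : ℕ, 0 < n → qInt q n ≠ 0) (n a : ℕ) :
    qInt q (n + 1) * gauss q n a = qInt q (n + 1 - a) * gauss q (n + 1) a := by
  rcases Nat.lt_or_ge n a with h | h
  · rw [gauss_of_lt h, show n + 1 - a = 0 by omega]; simp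
  · obtain ⟨c, rfl⟩ := Nat.exists_eq_add_of_le h
    have h2 := gauss_add (q := q) (c + 1) a
    rw [← add_assoc] at h2
    rw [gauss_add, h2, show a + c + 1 - a = c + 1 by omega, qFact_succ (a + c), qFact_succ c]
    have := qFact_ne_zero hn a
    have := qFact_ne_zero hn c
    have := hn (c + 1) c.succ_pos
    field_simp

lemma qInt_mul_gauss (hn : ∀ n : ℕ, 0 < n → qInt q n ≠ 0) (n a : ℕ) :
    qInt q (n + 1) * gauss q n a = qInt q (a + 1) * gauss q (n + 1) (a + 1) := by
  rw [qInt_mul_gauss_left hn, qInt_mul_gauss_succ hn]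

/-- One of the two quantum Pascal rules; it follows from `[n + 1] = [a + 1] q^c + [c] q^(-a - 1)`
with `n = a + c`. -/
lemma gauss_pascal (hq : q ≠ 0) (hn : ∀ n : ℕ, 0 < n → qInt q n ≠ 0) (n a : ℕ) :
    gauss q (n + 1) (a + 1) =
      q ^ (-((a : ℤ) + 1)) * gauss q n (a + 1) + q ^ ((n : ℤ) - a) * gauss q n a := by
  rcases Nat.lt_or_ge n a with h | h
  · rw [gauss_of_lt h, gauss_of_lt (by omega), gauss_of_lt (by omega)]; simp
  · refine mul_left_cancel₀ (hn (n + 1) n.succ_pos) ?_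
    have h1 := qInt_mul_gauss_left hn n (a + 1)
    have h2 := qInt_mul_gauss hn n a
    obtain ⟨c, rfl⟩ := Nat.exists_eq_add_of_le h
    have h3 := qInt_add hq (a + 1) c
    rw [show a + c + 1 - (a + 1) = c by omega] at h1
    rw [show a + 1 + c = a + c + 1 by ring] at h3
    push_cast at *
    rw [add_sub_cancel_left]
    linear_combination gauss q (a + c + 1) (a + 1) * h3
      - q ^ (-((a : ℤ) + 1)) * h1 - q ^ (c : ℤ) * h2

end QuantumIntegers

/-! ### Words as lists -/

section Words

/-- The number of pairs formed by a letter `x` and a letter `y` to the right of it. -/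
def pairCount (x y : Fin 2) : List (Fin 2) → ℕ
  | [] => 0
  | z :: l => (if z = x then l.count y else 0) + pairCount x y l

lemma pairCount_append (x y : Fin 2) (l l' : List (Fin 2)) :
    pairCount x y (l ++ l') =
      pairCount x y l + pairCount x y l' + l.count x * l'.count y := by
  induction l with
  | nil => simp [pairCount]
  | cons z l ih =>
    simp only [List.cons_append, pairCount, ih, List.count_append, List.count_cons]
    by_cases h : z = x
    · simp [h]; ring
    · simp [h]

lemma count_zero_add_count_one (l : List (Fin 2)) : l.count 0 + l.count 1 = l.length := by
  induction l with
  | nil => simp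
  | cons z l ih => fin_cases z <;> simp <;> omega

lemma card_filter_eq_count {n : ℕ} (w : Fin n → Fin 2) (y : Fin 2) :
    (Finset.univ.filter (fun i => w i = y)).card = (List.ofFn w).count y := by
  induction n with
  | zero => simp
  | succ n ih =>
    rw [Finset.card_filter, Fin.sum_univ_succ, List.ofFn_succ, List.count_cons, ← ih,
      Finset.card_filter, add_comm]
    simp

lemma card_filter_eq_pairCount {n : ℕ} (w : Fin n → Fin 2) (x y : Fin 2) :
    (Finset.univ.filter (fun p : Fin n × Fin n => p.1 < p.2 ∧ w p.1 = x ∧ w p.2 = y)).card =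
      pairCount x y (List.ofFn w) := by
  induction n with
  | zero => simp [pairCount]
  | succ n ih =>
    rw [Finset.card_filter, Fintype.sum_prod_type, Fin.sum_univ_succ, List.ofFn_succ, pairCount,
      ← ih, ← card_filter_eq_count, Finset.card_filter, Finset.card_filter, Fintype.sum_prod_type]
    simp only [Fin.sum_univ_succ, Fin.succ_lt_succ_iff]
    by_cases h : w 0 = x <;> simp [h]

lemma downs_eq {n : ℕ} (w : Fin n → Fin 2) : downs w = (List.ofFn w).count 1 :=
  card_filter_eq_count w 1

lemma normPlus_eq {n : ℕ} (w : Fin n → Fin 2) : normPlus w = pairCount 0 1 (List.ofFn w) :=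
  card_filter_eq_pairCount w 0 1

lemma normMinus_eq {n : ℕ} (w : Fin n → Fin 2) : normMinus w = pairCount 1 0 (List.ofFn w) :=
  card_filter_eq_pairCount w 1 0

lemma ofFn_insertNth {L : ℕ} (i : Fin (L + 1)) (x : Fin 2) (w : Fin L → Fin 2) :
    List.ofFn (Fin.insertNth (α := fun _ => Fin 2) i x w) =
      (List.ofFn w).take i ++ x :: (List.ofFn w).drop i := by
  have hi : (i : ℕ) ≤ L := Nat.le_of_lt_succ i.2
  refine List.ext_getElem (by simp; omega) fun j h1 h2 => ?_
  rw [List.getElem_ofFn]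
  rw [List.length_ofFn] at h1
  rcases lt_trichotomy j i with h | h | h
  · rw [Fin.insertNth_apply_below (by simpa [Fin.lt_def] using h),
      List.getElem_append_left (by simp; omega)]
    simp only [eq_rec_constant, List.getElem_take, List.getElem_ofFn]
    rfl
  · subst h
    rw [List.getElem_append_right (by simp)]
    simp [hi]
  · rw [Fin.insertNth_apply_above (by simpa [Fin.lt_def] using h),
      List.getElem_append_right (by simp; omega)]
    obtain ⟨c, rfl⟩ := Nat.exists_eq_add_of_lt h
    simp [hi, show (i : ℕ) + c + 1 - i = c + 1 by omega, Fin.pred]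

lemma ofFn_insertPair {L : ℕ} (i : Fin (L + 1)) (x y : Fin 2) (w : Fin L → Fin 2) :
    List.ofFn (insertPair i x y w) =
      (List.ofFn w).take i ++ x :: y :: (List.ofFn w).drop i := by
  have hi : (i : ℕ) ≤ L := Nat.le_of_lt_succ i.2
  rw [insertPair, ofFn_insertNth, ofFn_insertNth, Fin.val_succ]
  have h : ((List.ofFn w).take i).length = i := by simp [hi]
  rw [List.take_append, List.drop_append, h,
    List.take_of_length_le (by omega : ((List.ofFn w).take i).length ≤ i + 1),
    List.drop_of_length_le (by omega : ((List.ofFn w).take i).length ≤ i + 1)]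
  simp

end Words

/-! ### Bases of `V(n)` and of the tensor powers -/

section Basics

variable {F : Type*} [Field F] {q : F}

lemma vec_of_lt {n a : ℕ} (h : n < a) : vec F n a = 0 := by
  funext i
  simp only [vec, Pi.zero_apply, ite_eq_right_iff, one_ne_zero, imp_false]
  omega

lemma onBasis_vec {W : Type*} [AddCommGroup W] [Module F W] {n a : ℕ} (f : ℕ → W) (h : a ≤ n) :
    onBasis n f (vec F n a) = f a := by
  have : vec F n a = Pi.basisFun F (Fin (n + 1)) ⟨a, Nat.lt_succ_of_le h⟩ := by
    funext i
    simp [vec, Pi.single_apply, Fin.ext_iff]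
  rw [this, onBasis, Module.Basis.constr_basis]

lemma hom_ext_vec {W : Type*} [AddCommGroup W] [Module F W] {n : ℕ} {f g : V F n →ₗ[F] W}
    (h : ∀ a ≤ n, f (vec F n a) = g (vec F n a)) : f = g := by
  refine (Pi.basisFun F (Fin (n + 1))).ext fun i => ?_
  have : Pi.basisFun F (Fin (n + 1)) i = vec F n i := by
    funext j
    simp [vec, Pi.single_apply, Fin.ext_iff]
  rw [this]
  exact h i (Nat.le_of_lt_succ i.2)

/-- The divided power `F^a v^n / [a]!`, a multiple of `v^(n - 2a)`. The map `T_n^*` sends it to a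
sum over words without a denominator, so that formulas for maps become simplest on products of a `vec`
in one block and a `dvec` in the other. -/
def dvec (q : F) (n a : ℕ) : V F n := gauss q n a • vec F n a

lemma dvec_of_lt {n a : ℕ} (h : n < a) : dvec q n a = 0 := by
  rw [dvec, vec_of_lt h, smul_zero]

lemma hom_ext_dvec (hn : ∀ n : ℕ, 0 < n → qInt q n ≠ 0)
    {W : Type*} [AddCommGroup W] [Module F W] {n : ℕ} {f g : V F n →ₗ[F] W}
    (h : ∀ a ≤ n, f (dvec q n a) = g (dvec q n a)) : f = g := by
  refine hom_ext_vec fun a ha => ?_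
  have := h a ha
  simp only [dvec, map_smul] at this
  exact smul_right_injective _ (gauss_ne_zero hn ha) this

/-- The basis vector of `V(1)^{⊗ n}` given by a list of `n` letters. A longer list is truncated, a
shorter one is filled up with the letter `0`. -/
def word (F : Type*) [Field F] (n : ℕ) (l : List (Fin 2)) : Tens F n :=
  tensBasis F n (fun i => l.getD i 0)

lemma word_ofFn {n : ℕ} (w : Fin n → Fin 2) : word F n (List.ofFn w) = tensBasis F n w := by
  simp [word]

lemma ofFn_getD {n : ℕ} {l : List (Fin 2)} (h : l.length = n) :
    List.ofFn (fun i : Fin n => l.getD i 0) = l := by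
  subst h
  refine List.ext_getElem (by simp) fun i h1 h2 => ?_
  simp

lemma hom_ext_word {W : Type*} [AddCommGroup W] [Module F W] {n : ℕ} {f g : Tens F n →ₗ[F] W}
    (h : ∀ l : List (Fin 2), l.length = n → f (word F n l) = g (word F n l)) : f = g :=
  (tensBasis F n).ext fun w => by
    rw [← word_ofFn]
    exact h _ (List.length_ofFn)

lemma symT_word {n : ℕ} {l : List (Fin 2)} (h : l.length = n) :
    symT q n (word F n l) = q ^ pairCount 0 1 l • vec F n (l.count 1) := by
  rw [word, symT, Module.Basis.constr_basis, normPlus_eq, downs_eq, ofFn_getD h]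

lemma join_word {m n N : ℕ} (h : m + n = N) {l : List (Fin 2)} (hl : l.length = m)
    (l' : List (Fin 2)) :
    join F h (word F m l ⊗ₜ word F n l') = word F N (l ++ l') := by
  subst h
  simp only [join, word, tensBasis, Basis.piTensorProduct_apply, LinearEquiv.trans_apply,
    TensorPower.cast_refl, LinearEquiv.refl_apply]
  rw [← TensorPower.gMul_def, TensorPower.tprod_mul_tprod]
  congr 1
  funext i
  refine Fin.addCases (fun i => ?_) (fun i => ?_) i
  · rw [Fin.append_left]
    simp [List.getD_eq_getElem?_getD, List.getElem?_append_left, hl]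
  · rw [Fin.append_right]
    simp [List.getD_eq_getElem?_getD, List.getElem?_append_right, hl]

lemma join_assoc {a b c d e N : ℕ} (h₁ : a + d = N) (h₂ : b + c = d) (h₃ : e + c = N)
    (h₄ : a + b = e) (x : Tens F a) (y : Tens F b) (z : Tens F c) :
    join F h₁ (x ⊗ₜ join F h₂ (y ⊗ₜ z)) = join F h₃ (join F h₄ (x ⊗ₜ y) ⊗ₜ z) := by
  subst h₂ h₄ h₁
  simp only [join, LinearEquiv.trans_apply, TensorPower.cast_refl, LinearEquiv.refl_apply]
  simp only [← TensorPower.gMul_def]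
  exact (TensorPower.mul_assoc x y z).symm

end Basics

/-! ### Symmetrizers and the operators between two splittings -/

section Symmetrizers

variable {F : Type*} [Field F] {q : F}

/-- The map `V(m) ⊗ V(n) → V(N)` through which `T_N` factors, for `N = m + n`. -/
def merge (q : F) (m n N : ℕ) : VV F m n →ₗ[F] V F N :=
  TensorProduct.lift (onBasis m fun a => onBasis n fun b =>
    q ^ (((m : ℤ) - a) * b) • vec F N (a + b))

lemma merge_vec {m n N a b : ℕ} (ha : a ≤ m) (hb : b ≤ n) :
    merge q m n N (vec F m a ⊗ₜ vec F n b) = q ^ (((m : ℤ) - a) * b) • vec F N (a + b) := by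
  rw [merge, TensorProduct.lift.tmul, onBasis_vec _ ha, onBasis_vec _ hb]

lemma count_one_le (l : List (Fin 2)) : l.count 1 ≤ l.length := List.count_le_length

/-- `T_N` factors through `T_m ⊗ T_n`, because the pairs counted by `‖·‖₊` lie in one of the two
blocks or consist of an up arrow on the left and a down arrow on the right. -/
lemma symT_join {m n N : ℕ} (h : m + n = N) (x : Tens F m) (y : Tens F n) :
    symT q N (join F h (x ⊗ₜ y)) = merge q m n N (symT q m x ⊗ₜ symT q n y) := by
  have key : (TensorProduct.mk F _ _).compr₂ (symT q N ∘ₗ (join F h).toLinearMap) =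
      ((TensorProduct.mk F _ _).compr₂ (merge q m n N)).compl₁₂ (symT q m) (symT q n) := by
    refine hom_ext_word fun l hl => hom_ext_word fun l' hl' => ?_
    have h1 : l.count 1 ≤ m := hl ▸ count_one_le l
    have h2 : l'.count 1 ≤ n := hl' ▸ count_one_le l'
    have h3 : ((l.count 0 : ℕ) : ℤ) = m - l.count 1 := by
      have := count_zero_add_count_one l
      omega
    simp only [LinearMap.compr₂_apply, TensorProduct.mk_apply, LinearMap.comp_apply,
      LinearEquiv.coe_coe, LinearMap.compl₁₂_apply]
    rw [join_word h hl, symT_word (by simp [hl, hl', h]), symT_word hl, symT_word hl',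
      TensorProduct.smul_tmul_smul, map_smul, merge_vec h1 h2, smul_smul, pairCount_append,
      List.count_append, pow_add, pow_add, ← h3]
    norm_cast
  exact LinearMap.congr_fun₂ key x y

@[simp] lemma pairT_join {m n N : ℕ} (h : m + n = N) (x : Tens F m) (y : Tens F n) :
    pairT q h (join F h (x ⊗ₜ y)) = symT q m x ⊗ₜ symT q n y := by
  simp [pairT]

@[simp] lemma pairTstar_tmul {m n N : ℕ} (h : m + n = N) (x : V F m) (y : V F n) :
    pairTstar q h (x ⊗ₜ y) = join F h (symTstar q m x ⊗ₜ symTstar q n y) := by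
  simp [pairTstar]

/-- The sum of the `q^{-‖w‖₋} w` over the words `w` of length `n` with `a` down arrows. -/
def symVec (q : F) (n a : ℕ) : Tens F n :=
  ∑ w ∈ Finset.univ.filter (fun w : Fin n → Fin 2 => downs w = a),
    (q ^ normMinus w)⁻¹ • tensBasis F n w

lemma symVec_eq (n a : ℕ) : symVec q n a = ∑ w : Fin n → Fin 2,
    if (List.ofFn w).count 1 = a then
      (q ^ pairCount 1 0 (List.ofFn w))⁻¹ • word F n (List.ofFn w) else 0 := by
  rw [symVec, Finset.sum_filter]
  simp only [normMinus_eq, downs_eq, word_ofFn]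

lemma symVec_of_lt {n a : ℕ} (h : n < a) : symVec q n a = 0 := by
  rw [symVec_eq]
  refine Finset.sum_eq_zero fun w _ => if_neg ?_
  have := count_one_le (List.ofFn w)
  rw [List.length_ofFn] at this
  omega

/-- The splitting of the words of length `m + n` into two blocks. -/
lemma symVec_add (hq : q ≠ 0) {m n N : ℕ} (h : m + n = N) (b : ℕ) :
    symVec q N b = ∑ p ∈ Finset.HasAntidiagonal.antidiagonal b,
      q ^ (-(p.1 : ℤ) * (n - p.2)) • join F h (symVec q m p.1 ⊗ₜ symVec q n p.2) := by
  subst h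
  have key : ∀ (x : Fin m → Fin 2) (y : Fin n → Fin 2),
      (if (List.ofFn (Fin.append x y)).count 1 = b then
        (q ^ pairCount 1 0 (List.ofFn (Fin.append x y)))⁻¹ •
          word F (m + n) (List.ofFn (Fin.append x y)) else 0) =
      ∑ p ∈ Finset.HasAntidiagonal.antidiagonal b, q ^ (-(p.1 : ℤ) * (n - p.2)) • join F rfl
        ((if (List.ofFn x).count 1 = p.1 then
            (q ^ pairCount 1 0 (List.ofFn x))⁻¹ • word F m (List.ofFn x) else 0) ⊗ₜ
          (if (List.ofFn y).count 1 = p.2 then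
            (q ^ pairCount 1 0 (List.ofFn y))⁻¹ • word F n (List.ofFn y) else 0)) := by
    intro x y
    have hy : (((List.ofFn y).count 0 : ℕ) : ℤ) = n - (List.ofFn y).count 1 := by
      have := count_zero_add_count_one (List.ofFn y)
      rw [List.length_ofFn] at this
      omega
    rw [List.ofFn_fin_append, List.count_append]
    by_cases hb : (List.ofFn x).count 1 + (List.ofFn y).count 1 = b
    · rw [if_pos hb, Finset.sum_eq_single ((List.ofFn x).count 1, (List.ofFn y).count 1)]
      · rw [if_pos rfl, if_pos rfl, TensorProduct.smul_tmul_smul, map_smul,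
          join_word rfl List.length_ofFn, smul_smul, pairCount_append, ← hy]
        congr 1
        rw [← mul_inv, ← pow_add, ← zpow_natCast, ← zpow_natCast, ← zpow_neg, ← zpow_neg,
          ← zpow_add₀ hq]
        congr 1
        push_cast
        ring
      · rintro ⟨i, j⟩ - hij
        by_cases hi : (List.ofFn x).count 1 = i
        · rw [if_neg (c := (List.ofFn y).count 1 = j) (by rintro rfl; exact hij (by rw [hi])),
            TensorProduct.tmul_zero, LinearEquiv.map_zero, smul_zero]
        · rw [if_neg hi, TensorProduct.zero_tmul, LinearEquiv.map_zero, smul_zero]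
      · intro h
        exact absurd (Finset.HasAntidiagonal.mem_antidiagonal.2 hb) h
    · rw [if_neg hb]
      refine (Finset.sum_eq_zero ?_).symm
      rintro ⟨i, j⟩ hij
      rw [Finset.HasAntidiagonal.mem_antidiagonal] at hij
      by_cases hi : (List.ofFn x).count 1 = i
      · rw [if_neg (c := (List.ofFn y).count 1 = j) (by rintro rfl; exact hb (by rw [hi, ← hij])),
          TensorProduct.tmul_zero, LinearEquiv.map_zero, smul_zero]
      · rw [if_neg hi, TensorProduct.zero_tmul, LinearEquiv.map_zero, smul_zero]
  simp only [symVec_eq, TensorProduct.sum_tmul, TensorProduct.tmul_sum, map_sum, Finset.smul_sum]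
  rw [← (Fin.appendEquiv m n).sum_comp, Fintype.sum_prod_type]
  refine (Finset.sum_congr rfl fun x _ => Finset.sum_congr rfl fun y _ => key x y).trans ?_
  conv_rhs => rw [Finset.sum_comm]
  conv_lhs => rw [Finset.sum_comm]
  refine Finset.sum_congr rfl fun y _ => ?_
  rw [Finset.sum_comm]

lemma symTstar_dvec (hn : ∀ n : ℕ, 0 < n → qInt q n ≠ 0) (n a : ℕ) :
    symTstar q n (dvec q n a) = symVec q n a := by
  rcases Nat.lt_or_ge n a with h | h
  · rw [dvec_of_lt h, symVec_of_lt h, map_zero]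
  · rw [dvec, map_smul, symTstar, onBasis_vec _ h, ← symVec, smul_smul, gauss, if_pos h,
      mul_inv_cancel₀, one_smul]
    have := gauss_ne_zero hn h
    rwa [gauss, if_pos h] at this

lemma symVec_one_zero : symVec q 1 0 = word F 1 [0] := by
  rw [symVec_eq, ← (Equiv.funUnique (Fin 1) (Fin 2)).symm.sum_comp]
  simp [pairCount]

lemma symVec_one_one : symVec q 1 1 = word F 1 [1] := by
  rw [symVec_eq, ← (Equiv.funUnique (Fin 1) (Fin 2)).symm.sum_comp]
  simp [pairCount]

lemma symVec_zero_zero : symVec q 0 0 = word F 0 [] := by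
  rw [symVec_eq]
  simp [pairCount]

/-- This amounts to `∑ q^(‖w‖₊ - ‖w‖₋)` over the words with `a` down arrows being the quantum
binomial coefficient, and the induction step to the Pascal rule. -/
lemma symT_symVec (hq : q ≠ 0) (hn : ∀ n : ℕ, 0 < n → qInt q n ≠ 0) (n a : ℕ) :
    symT q n (symVec q n a) = dvec q n a := by
  induction n generalizing a with
  | zero =>
    rcases a with _ | a
    · rw [symVec_zero_zero, symT_word (by rfl), dvec, gauss_zero_right hn]
      simp [pairCount]
    · rw [symVec_of_lt (by omega), dvec_of_lt (by omega), map_zero]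
  | succ n ih =>
    have h0 : symT q 1 (symVec q 1 0) = vec F 1 0 := by
      rw [symVec_one_zero, symT_word (by rfl)]; simp [pairCount]
    have h1 : symT q 1 (symVec q 1 1) = vec F 1 1 := by
      rw [symVec_one_one, symT_word (by rfl)]; simp [pairCount]
    have hm : ∀ a b, b ≤ 1 → merge q n 1 (n + 1) (dvec q n a ⊗ₜ vec F 1 b) =
        (gauss q n a * q ^ (((n : ℤ) - a) * b)) • vec F (n + 1) (a + b) := by
      intro a b hb
      rcases Nat.lt_or_ge n a with h | h
      · rw [dvec_of_lt h, gauss_of_lt h]; simp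
      · rw [dvec, ← TensorProduct.smul_tmul', map_smul, merge_vec h hb, smul_smul]
    rw [symVec_add hq (rfl : n + 1 = n + 1), map_sum]
    simp only [map_smul, symT_join, ih]
    rcases a with _ | a
    · have := hm 0 0 zero_le_one
      simp only [gauss_zero_right hn, dvec, one_smul] at this
      simp [h0, this, dvec, gauss_zero_right hn]
    · rw [Finset.Nat.sum_antidiagonal_succ', Finset.sum_eq_single (a, 0)]
      · simp only [h0, h1, hm, zero_le, le_refl, zero_add]
        rw [smul_smul, smul_smul, add_zero, ← add_smul, dvec, gauss_pascal hq hn]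
        congr 1
        push_cast
        ring_nf
        simp
      · rintro ⟨i, j⟩ hij hne
        rw [Finset.HasAntidiagonal.mem_antidiagonal] at hij
        dsimp only at hij ⊢
        rw [symVec_of_lt (a := j + 1), map_zero, TensorProduct.tmul_zero, map_zero, smul_zero]
        rcases j with _ | j
        · exact absurd (by simpa using hij) (by simpa using hne)
        · omega
      · simp

lemma symT_symTstar (hq : q ≠ 0) (hn : ∀ n : ℕ, 0 < n → qInt q n ≠ 0) (n : ℕ) (x : V F n) :
    symT q n (symTstar q n x) = x := by
  have : symT q n ∘ₗ symTstar q n = LinearMap.id := hom_ext_dvec hn fun a _ => by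
    rw [LinearMap.comp_apply, symTstar_dvec hn, symT_symVec hq hn, LinearMap.id_apply]
  exact LinearMap.congr_fun this x

/-- Splitting a symmetrized word: the embedding `V(N) → V(m) ⊗ V(n)` for `N = m + n`. -/
lemma pairT_symVec (hq : q ≠ 0) (hn : ∀ n : ℕ, 0 < n → qInt q n ≠ 0) {m n N : ℕ} (h : m + n = N)
    (b : ℕ) : pairT q h (symVec q N b) = ∑ p ∈ Finset.HasAntidiagonal.antidiagonal b,
      q ^ (-(p.1 : ℤ) * (n - p.2)) • dvec q m p.1 ⊗ₜ dvec q n p.2 := by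
  simp only [symVec_add hq h, map_sum, map_smul, pairT_join, symT_symVec hq hn]

/-- Two smaller symmetrizers are absorbed by a larger one. -/
lemma pairTstar_pairT_symTstar (hq : q ≠ 0) (hn : ∀ n : ℕ, 0 < n → qInt q n ≠ 0) {m n N : ℕ}
    (h : m + n = N) (x : V F N) :
    pairTstar q h (pairT q h (symTstar q N x)) = symTstar q N x := by
  have : pairTstar q h ∘ₗ pairT q h ∘ₗ symTstar q N = symTstar q N :=
    hom_ext_dvec hn fun a _ => by
      simp only [LinearMap.comp_apply, symTstar_dvec hn, pairT_symVec hq hn, map_sum, map_smul,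
        pairTstar_tmul]
      exact (symVec_add hq h a).symm
  exact LinearMap.congr_fun this x

lemma merge_dvec {m n N a b : ℕ} (ha : a ≤ m) : merge q m n N (vec F m a ⊗ₜ dvec q n b) =
    (q ^ (((m : ℤ) - a) * b) * gauss q n b) • vec F N (a + b) := by
  rcases Nat.lt_or_ge n b with h | h
  · rw [dvec_of_lt h, gauss_of_lt h]; simp
  · rw [dvec, TensorProduct.tmul_smul, map_smul, merge_vec ha h, smul_smul, mul_comm]

lemma merge_dvec_left {m n N a b : ℕ} (hb : b ≤ n) : merge q m n N (dvec q m a ⊗ₜ vec F n b) =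
    (q ^ (((m : ℤ) - a) * b) * gauss q m a) • vec F N (a + b) := by
  rcases Nat.lt_or_ge m a with h | h
  · rw [dvec_of_lt h, gauss_of_lt h]; simp
  · rw [dvec, ← TensorProduct.smul_tmul', map_smul, merge_vec h hb, smul_smul, mul_comm]

/-- `opU` moves `k` factors from the right block to the left one: `dvec q n b` is split into `k` and
`n'` factors, and the first `k` of them are merged into the left block. -/
lemma opU_right (hq : q ≠ 0) (hn : ∀ n : ℕ, 0 < n → qInt q n ≠ 0) {m n m' n' : ℕ}
    (h : m' + n' = m + n) (k : ℕ) (hk : m' = m + k) {a : ℕ} (ha : a ≤ m) (b : ℕ) :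
    opU q h (vec F m a ⊗ₜ dvec q n b) = ∑ p ∈ Finset.HasAntidiagonal.antidiagonal b,
      (q ^ ((p.1 : ℤ) * (m - a - n' + p.2)) * gauss q k p.1) •
        vec F m' (a + p.1) ⊗ₜ[F] dvec q n' p.2 := by
  subst hk
  have h2 : k + n' = n := by omega
  simp only [opU, LinearMap.comp_apply, pairTstar_tmul, symTstar_dvec hn, symVec_add hq h2,
    TensorProduct.tmul_sum, TensorProduct.tmul_smul, map_sum, map_smul,
    join_assoc rfl h2 h rfl, pairT_join, symT_join, symT_symTstar hq hn, symT_symVec hq hn,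
    merge_dvec ha]
  refine Finset.sum_congr rfl fun p _ => ?_
  rw [← TensorProduct.smul_tmul', smul_smul, ← mul_assoc, ← zpow_add₀ hq]
  congr 3
  ring

/-- `opU` moves `k` factors from the left block to the right one. -/
lemma opU_left (hq : q ≠ 0) (hn : ∀ n : ℕ, 0 < n → qInt q n ≠ 0) {m n m' n' : ℕ}
    (h : m' + n' = m + n) (k : ℕ) (hk : m = m' + k) (a : ℕ) {b : ℕ} (hb : b ≤ n) :
    opU q h (dvec q m a ⊗ₜ vec F n b) = ∑ p ∈ Finset.HasAntidiagonal.antidiagonal a,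
      (q ^ (((k : ℤ) - p.2) * (b - p.1)) * gauss q k p.2) •
        dvec q m' p.1 ⊗ₜ[F] vec F n' (p.2 + b) := by
  subst hk
  have h2 : k + n = n' := by omega
  simp only [opU, LinearMap.comp_apply, pairTstar_tmul, symTstar_dvec hn,
    symVec_add hq (rfl : m' + k = m' + k), TensorProduct.sum_tmul, ← TensorProduct.smul_tmul',
    map_sum, map_smul, ← join_assoc h h2 rfl rfl, pairT_join, symT_join, symT_symTstar hq hn,
    symT_symVec hq hn, merge_dvec_left hb]
  refine Finset.sum_congr rfl fun p _ => ?_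
  rw [TensorProduct.tmul_smul, smul_smul, ← mul_assoc, ← zpow_add₀ hq]
  congr 3
  ring

end Symmetrizers

/-! ### The middle cap -/

section MiddleCap

variable {F : Type*} [Field F] {q : F}

/-- The map `V(m) ⊗ V(n) → V(m + 1) ⊗ V(n + 1)` that the cap joining the two blocks induces (see
`pairT_insertCap_middle`). -/
def midCap (q : F) (m n : ℕ) : VV F m n →ₗ[F] VV F (m + 1) (n + 1) :=
  TensorProduct.lift (onBasis m fun a => onBasis n fun b =>
    q ^ ((m : ℤ) - a + b) • vec F (m + 1) (a + 1) ⊗ₜ[F] vec F (n + 1) b -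
      q⁻¹ • vec F (m + 1) a ⊗ₜ[F] vec F (n + 1) (b + 1))

lemma midCap_vec {m n a b : ℕ} (ha : a ≤ m) (hb : b ≤ n) :
    midCap q m n (vec F m a ⊗ₜ vec F n b) =
      q ^ ((m : ℤ) - a + b) • vec F (m + 1) (a + 1) ⊗ₜ[F] vec F (n + 1) b -
        q⁻¹ • vec F (m + 1) a ⊗ₜ[F] vec F (n + 1) (b + 1) := by
  rw [midCap, TensorProduct.lift.tmul, onBasis_vec _ ha, onBasis_vec _ hb]

lemma qInt_smul_dvec_left (hn : ∀ n : ℕ, 0 < n → qInt q n ≠ 0) (n b : ℕ) :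
    (qInt q (n + 1) * gauss q n b) • vec F (n + 1) b =
      qInt q (n + 1 - b) • dvec q (n + 1) b := by
  rw [qInt_mul_gauss_left hn, mul_smul, dvec]

lemma qInt_smul_dvec (hn : ∀ n : ℕ, 0 < n → qInt q n ≠ 0) (n b : ℕ) :
    (qInt q (n + 1) * gauss q n b) • vec F (n + 1) (b + 1) =
      qInt q (b + 1) • dvec q (n + 1) (b + 1) := by
  rw [qInt_mul_gauss hn, mul_smul, dvec]

lemma midCap_dvec_right (hn : ∀ n : ℕ, 0 < n → qInt q n ≠ 0) {m a : ℕ} (n b : ℕ) (ha : a ≤ m) :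
    qInt q (n + 1) • midCap q m n (vec F m a ⊗ₜ dvec q n b) =
      (q ^ ((m : ℤ) - a + b) * qInt q (n + 1 - b)) •
          vec F (m + 1) (a + 1) ⊗ₜ[F] dvec q (n + 1) b -
        (q⁻¹ * qInt q (b + 1)) • vec F (m + 1) a ⊗ₜ[F] dvec q (n + 1) (b + 1) := by
  rcases Nat.lt_or_ge n b with h | h
  · rw [dvec_of_lt h, dvec_of_lt (by omega : n + 1 < b + 1), show n + 1 - b = 0 by omega]
    simp
  · rw [mul_smul, mul_smul, ← TensorProduct.tmul_smul, ← TensorProduct.tmul_smul (qInt q (b + 1)),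
      ← qInt_smul_dvec hn, ← qInt_smul_dvec_left hn, dvec, TensorProduct.tmul_smul, map_smul,
      midCap_vec ha h, smul_smul, smul_sub, TensorProduct.tmul_smul, TensorProduct.tmul_smul,
      smul_comm _ q⁻¹, smul_comm _ (q ^ _)]

lemma midCap_dvec_left (hn : ∀ n : ℕ, 0 < n → qInt q n ≠ 0) (m a : ℕ) {n b : ℕ} (hb : b ≤ n) :
    qInt q (m + 1) • midCap q m n (dvec q m a ⊗ₜ vec F n b) =
      (q ^ ((m : ℤ) - a + b) * qInt q (a + 1)) •
          dvec q (m + 1) (a + 1) ⊗ₜ[F] vec F (n + 1) b -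
        (q⁻¹ * qInt q (m + 1 - a)) • dvec q (m + 1) a ⊗ₜ[F] vec F (n + 1) (b + 1) := by
  rcases Nat.lt_or_ge m a with h | h
  · rw [dvec_of_lt h, dvec_of_lt (by omega : m + 1 < a + 1), show m + 1 - a = 0 by omega]
    simp
  · rw [mul_smul, mul_smul, TensorProduct.smul_tmul', TensorProduct.smul_tmul' (qInt q (m + 1 - a)),
      ← qInt_smul_dvec hn, ← qInt_smul_dvec_left hn, dvec, ← TensorProduct.smul_tmul', map_smul,
      midCap_vec h hb, smul_smul, smul_sub, ← TensorProduct.smul_tmul', ← TensorProduct.smul_tmul',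
      smul_comm _ q⁻¹, smul_comm _ (q ^ _)]

lemma hom_ext_vec_dvec (hn : ∀ n : ℕ, 0 < n → qInt q n ≠ 0)
    {W : Type*} [AddCommGroup W] [Module F W] {m n : ℕ} {f g : VV F m n →ₗ[F] W}
    (h : ∀ a ≤ m, ∀ b ≤ n, f (vec F m a ⊗ₜ dvec q n b) = g (vec F m a ⊗ₜ dvec q n b)) : f = g :=
  TensorProduct.ext <| hom_ext_vec fun a ha => hom_ext_dvec hn fun b hb => h a ha b hb

lemma hom_ext_dvec_vec (hn : ∀ n : ℕ, 0 < n → qInt q n ≠ 0)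
    {W : Type*} [AddCommGroup W] [Module F W] {m n : ℕ} {f g : VV F m n →ₗ[F] W}
    (h : ∀ a ≤ m, ∀ b ≤ n, f (dvec q m a ⊗ₜ vec F n b) = g (dvec q m a ⊗ₜ vec F n b)) : f = g :=
  TensorProduct.ext <| hom_ext_dvec hn fun a ha => hom_ext_vec fun b hb => h a ha b hb

lemma hom_ext_vec_vec {W : Type*} [AddCommGroup W] [Module F W] {m n : ℕ} {f g : VV F m n →ₗ[F] W}
    (h : ∀ a ≤ m, ∀ b ≤ n, f (vec F m a ⊗ₜ vec F n b) = g (vec F m a ⊗ₜ vec F n b)) : f = g :=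
  TensorProduct.ext <| hom_ext_vec fun a ha => hom_ext_vec fun b hb => h a ha b hb

open Finset.HasAntidiagonal in
/-- The composite of `opU` with the middle cap, for a right block of arbitrary length `n'` in the
target. For `n' = 0` the right-hand side vanishes; for `n' > 0` it is a multiple of the middle cap
after `opU`. -/
lemma opU_midCap_right (hq : q ≠ 0) (hn : ∀ n : ℕ, 0 < n → qInt q n ≠ 0) {m n m' n' : ℕ}
    (h : m' + n' = m + 1 + (n + 1)) (k : ℕ) (hk : m' = m + 1 + k) {a : ℕ} (ha : a ≤ m) (b : ℕ) :
    qInt q (n + 1) • opU q h (midCap q m n (vec F m a ⊗ₜ dvec q n b)) =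
      ∑ p ∈ antidiagonal b, (q ^ ((p.1 : ℤ) * (m - a - n' + 1 + p.2)) * gauss q k p.1) •
        ((q ^ ((m : ℤ) + k - a - p.1 + p.2) * qInt q (n' - p.2)) •
            vec F m' (a + p.1 + 1) ⊗ₜ[F] dvec q n' p.2 -
          (q⁻¹ * qInt q (p.2 + 1)) • vec F m' (a + p.1) ⊗ₜ[F] dvec q n' (p.2 + 1)) := by
  have hnn : n + 1 = n' + k := by omega
  rw [← map_smul, midCap_dvec_right hn n b ha, map_sub, map_smul, map_smul,
    opU_right hq hn h k hk (by omega), opU_right hq hn h k hk (by omega),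
    Finset.Nat.sum_antidiagonal_succ]
  simp only [smul_sub, Finset.sum_sub_distrib]
  -- the second sum on the right, reindexed like the second sum on the left
  have hH := Finset.Nat.sum_antidiagonal_succ (n := b) (f := fun p : ℕ × ℕ =>
    (q ^ ((p.1 : ℤ) * (m - a - n' + p.2)) * gauss q k p.1 * (q⁻¹ * qInt q p.2)) •
      vec F m' (a + p.1) ⊗ₜ[F] dvec q n' p.2)
  rw [Finset.Nat.sum_antidiagonal_succ'] at hH
  simp only [qInt_zero, mul_zero, zero_smul, zero_add] at hH
  have hH' : ∑ p ∈ antidiagonal b, (q ^ ((p.1 : ℤ) * (m - a - n' + 1 + p.2)) * gauss q k p.1) •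
      (q⁻¹ * qInt q (p.2 + 1)) • vec F m' (a + p.1) ⊗ₜ[F] dvec q n' (p.2 + 1) =
      ∑ p ∈ antidiagonal b,
        (q ^ ((p.1 : ℤ) * (m - a - n' + (p.2 + 1 : ℕ))) * gauss q k p.1 *
          (q⁻¹ * qInt q (p.2 + 1))) • vec F m' (a + p.1) ⊗ₜ[F] dvec q n' (p.2 + 1) := by
    refine Finset.sum_congr rfl fun p _ => ?_
    rw [smul_smul]
    congr 4
    push_cast
    ring
  rw [hH', hH, smul_add, sub_add_eq_sub_sub_swap, sub_add_eq_sub_sub_swap]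
  congr 1
  · simp only [Finset.smul_sum, ← Finset.sum_sub_distrib]
    refine Finset.sum_congr rfl ?_
    rintro ⟨c, d⟩ hp
    rw [mem_antidiagonal] at hp
    dsimp only at hp ⊢
    subst hp
    rcases Nat.lt_or_ge n' d with hd | hd
    · rw [dvec_of_lt hd]; simp
    rcases Nat.lt_or_ge k c with hc | hc
    · rw [gauss_of_lt hc, gauss_of_lt (by omega)]; simp
    obtain ⟨s, rfl⟩ := Nat.exists_eq_add_of_le hd
    obtain ⟨t, rfl⟩ := Nat.exists_eq_add_of_le hc
    rw [show a + 1 + c = a + c + 1 by ring, show a + (c + 1) = a + c + 1 by ring]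
    simp only [smul_smul, ← sub_smul]
    congr 1
    have e1 := qInt_mul_gauss_succ hn (c + t) c
    have e2 := qInt_add hq s t
    have e3 := qInt_add hq (c + 1) d
    rw [show n + 1 - (c + d) = s + t by omega, show c + d + 1 = c + 1 + d by ring, e2, e3,
      show d + s - d = s by omega]
    rw [show c + t - c = t by omega] at e1
    generalize gauss q (c + t) (c + 1) = g' at *
    generalize gauss q (c + t) c = g at *
    clear e2 e3 hH hH'
    push_cast
    have h1 : q ^ ((m : ℤ) - a + (c + d)) * q ^ (t : ℤ) *
        q ^ ((c : ℤ) * (m + 1 - (a + 1) - (d + s) + d)) =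
        q ^ ((c : ℤ) * (m - a - (d + s) + 1 + d)) * q ^ ((m : ℤ) + (c + t) - a - c + d) := by
      simp only [← zpow_add₀ hq]
      congr 1
      ring
    have h2 : q ^ ((m : ℤ) - a + (c + d)) * q ^ (-(s : ℤ)) *
        q ^ ((c : ℤ) * (m + 1 - (a + 1) - (d + s) + d)) =
        q⁻¹ * q ^ (d : ℤ) * q ^ (((c : ℤ) + 1) * (m + 1 - a - (d + s) + d)) := by
      rw [← zpow_neg_one]
      simp only [← zpow_add₀ hq]
      congr 1
      ring
    have h3 : q ^ (-((c : ℤ) + 1)) * q ^ (((c : ℤ) + 1) * (m + 1 - a - (d + s) + d)) =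
        q ^ (((c : ℤ) + 1) * (m - a - (d + s) + d)) := by
      simp only [← zpow_add₀ hq]
      congr 1
      ring
    linear_combination (qInt q s * g) * h1 + (qInt q t * g) * h2 - (q⁻¹ * qInt q d * g') * h3
      - (q⁻¹ * q ^ (d : ℤ) * q ^ (((c : ℤ) + 1) * (m + 1 - a - (d + s) + d))) * e1
  · rw [smul_smul]
    congr 1
    simp only [Nat.cast_zero, zero_mul, zpow_zero]
    ring

open Finset.HasAntidiagonal in
/-- `opU` and the middle cap commute up to a ratio of quantum integers when factors move from the
left block to the right one. -/
lemma opU_midCap_left (hq : q ≠ 0) (hn : ∀ n : ℕ, 0 < n → qInt q n ≠ 0) {m n m' n' : ℕ}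
    (h : m' + n' = m + n) (h' : m' + 1 + (n' + 1) = m + 1 + (n + 1)) (k : ℕ) (hk : m = m' + k) :
    qInt q (m + 1) • (opU q h' ∘ₗ midCap q m n) =
      qInt q (m' + 1) • (midCap q m' n' ∘ₗ opU q h) := by
  refine hom_ext_dvec_vec hn fun a ha b hb => ?_
  simp only [LinearMap.smul_apply, LinearMap.comp_apply]
  rw [← map_smul, midCap_dvec_left hn m a hb, map_sub, map_smul, map_smul,
    opU_left hq hn h' k (by omega) _ (by omega), opU_left hq hn h' k (by omega) _ (by omega),
    opU_left hq hn h k hk _ hb, Finset.Nat.sum_antidiagonal_succ']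
  simp only [map_sum, map_smul, Finset.smul_sum, smul_comm (qInt q (m' + 1))]
  have hC : ∀ p ∈ antidiagonal a,
      (q ^ (((k : ℤ) - p.2) * (b - p.1)) * gauss q k p.2) •
        (qInt q (m' + 1) • midCap q m' n' (dvec q m' p.1 ⊗ₜ vec F n' (p.2 + b))) =
      (q ^ (((k : ℤ) - p.2) * (b - p.1)) * gauss q k p.2) •
        ((q ^ ((m' : ℤ) - p.1 + (p.2 + b : ℕ)) * qInt q (p.1 + 1)) •
          dvec q (m' + 1) (p.1 + 1) ⊗ₜ[F] vec F (n' + 1) (p.2 + b) -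
        (q⁻¹ * qInt q (m' + 1 - p.1)) •
          dvec q (m' + 1) p.1 ⊗ₜ[F] vec F (n' + 1) (p.2 + b + 1)) := by
    intro p _
    rcases Nat.lt_or_ge k p.2 with hp | hp
    · rw [gauss_of_lt hp]; simp
    · rw [midCap_dvec_left hn m' p.1 (by omega)]
  rw [Finset.sum_congr rfl hC]
  simp only [smul_sub, Finset.sum_sub_distrib]
  -- the first sum on the right, reindexed like the first sum on the left
  have hH := Finset.Nat.sum_antidiagonal_succ' (n := a) (f := fun p : ℕ × ℕ =>
    (q ^ (((k : ℤ) - p.2) * (b - p.1 + 1)) * gauss q k p.2 *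
      (q ^ ((m' : ℤ) - p.1 + 1 + p.2 + b) * qInt q p.1)) •
      dvec q (m' + 1) p.1 ⊗ₜ[F] vec F (n' + 1) (p.2 + b))
  rw [Finset.Nat.sum_antidiagonal_succ] at hH
  simp only [qInt_zero, mul_zero, zero_smul, zero_add] at hH
  have hH' : ∑ p ∈ antidiagonal a, (q ^ (((k : ℤ) - p.2) * (b - p.1)) * gauss q k p.2) •
      (q ^ ((m' : ℤ) - p.1 + (p.2 + b : ℕ)) * qInt q (p.1 + 1)) •
        dvec q (m' + 1) (p.1 + 1) ⊗ₜ[F] vec F (n' + 1) (p.2 + b) =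
      ∑ p ∈ antidiagonal a,
        (q ^ (((k : ℤ) - p.2) * (b - (p.1 + 1 : ℕ) + 1)) * gauss q k p.2 *
          (q ^ ((m' : ℤ) - (p.1 + 1 : ℕ) + 1 + p.2 + b) * qInt q (p.1 + 1))) •
        dvec q (m' + 1) (p.1 + 1) ⊗ₜ[F] vec F (n' + 1) (p.2 + b) := by
    refine Finset.sum_congr rfl fun p _ => ?_
    rw [smul_smul]
    congr 4
    · push_cast
      ring_nf
    · push_cast
      ring_nf
  rw [hH', hH, smul_add, add_sub_assoc, add_sub_assoc]
  congr 1
  · rw [smul_smul, ← mul_assoc, ← mul_assoc]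
    congr 1
    subst hk
    have h1 : q ^ (((m' + k : ℕ) : ℤ) - a + b) * q ^ (((k : ℤ) - (0 : ℕ)) * (b - (a + 1 : ℕ))) =
        q ^ (((k : ℤ) - (0 : ℕ)) * (b - (a + 1 : ℕ) + 1)) *
          q ^ ((m' : ℤ) - (a + 1 : ℕ) + 1 + (0 : ℕ) + b) := by
      simp only [← zpow_add₀ hq]
      congr 1
      push_cast
      ring
    · linear_combination (qInt q (a + 1) * gauss q k 0) * h1
    · rw [zero_add]
  · simp only [Finset.smul_sum, ← Finset.sum_sub_distrib]
    refine Finset.sum_congr rfl ?_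
    rintro ⟨i, c⟩ hp
    rw [mem_antidiagonal] at hp
    dsimp only at hp ⊢
    subst hp
    rcases Nat.lt_or_ge (m' + 1) i with hi | hi
    · rw [dvec_of_lt hi]; simp
    rcases Nat.lt_or_ge k c with hc | hc
    · rw [gauss_of_lt hc, gauss_of_lt (by omega)]; simp
    obtain ⟨s, hs⟩ := Nat.exists_eq_add_of_le hi
    obtain ⟨t, rfl⟩ := Nat.exists_eq_add_of_le hc
    rw [show c + 1 + b = c + b + 1 by ring, show c + (b + 1) = c + b + 1 by ring]
    simp only [smul_smul]
    rw [← sub_smul]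
    refine Eq.trans ?_ (sub_smul (M := VV F (m' + 1) (n' + 1)) _ _ _)
    congr 1
    have e1 := qInt_mul_gauss_succ hn (c + t) c
    have e2 := qInt_add hq t s
    have e3 := qInt_add hq i (c + 1)
    rw [show m + 1 - (i + c) = t + s by omega, show i + c + 1 = i + (c + 1) by ring, e2, e3,
      show m' + 1 - i = s by omega]
    rw [show c + t - c = t by omega] at e1
    have hm' : (m' : ℤ) = i + s - 1 := by omega
    have hm : (m : ℤ) = i + s - 1 + (c + t) := by omega
    rw [hm', hm]
    generalize gauss q (c + t) (c + 1) = g' at *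
    generalize gauss q (c + t) c = g at *
    clear e2 e3 hH hH' hC
    push_cast
    have h1 : q ^ ((i : ℤ) + s - 1 + (c + t) - (i + c) + b) * q ^ ((c : ℤ) + 1) *
        q ^ (((c : ℤ) + t - (c + 1)) * (b - i)) =
        q ^ (((c : ℤ) + t - (c + 1)) * (b - i + 1)) *
          q ^ ((i : ℤ) + s - 1 - i + 1 + (c + 1) + b) := by
      simp only [← zpow_add₀ hq]
      congr 1
      ring
    have h2 : q ^ ((i : ℤ) + s - 1 + (c + t) - (i + c) + b) * q ^ (-(i : ℤ)) *
        q ^ (((c : ℤ) + t - (c + 1)) * (b - i)) =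
        q⁻¹ * q ^ (s : ℤ) * q ^ (((c : ℤ) + t - c) * (b + 1 - i)) := by
      rw [← zpow_neg_one]
      simp only [← zpow_add₀ hq]
      congr 1
      ring
    have h3 : q ^ (-(t : ℤ)) * q ^ (((c : ℤ) + t - c) * (b + 1 - i)) =
        q ^ (((c : ℤ) + t - c) * (b - i)) := by
      simp only [← zpow_add₀ hq]
      congr 1
      ring
    linear_combination (qInt q i * g') * h1 + (qInt q t * g) * h2 - (q⁻¹ * qInt q s * g) * h3
      + (q ^ ((i : ℤ) + s - 1 + (c + t) - (i + c) + b) * q ^ (-(i : ℤ)) *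
        q ^ (((c : ℤ) + t - (c + 1)) * (b - i))) * e1

/-- `opU` and the middle cap commute up to a ratio of quantum integers when factors move from the
right block to the left one. -/
lemma opU_midCap_right_succ (hq : q ≠ 0) (hn : ∀ n : ℕ, 0 < n → qInt q n ≠ 0) {m n m' n' : ℕ}
    (h : m' + n' = m + n) (h' : m' + 1 + (n' + 1) = m + 1 + (n + 1)) (k : ℕ) (hk : m' = m + k) :
    qInt q (n + 1) • (opU q h' ∘ₗ midCap q m n) =
      qInt q (n' + 1) • (midCap q m' n' ∘ₗ opU q h) := by
  refine hom_ext_vec_dvec hn fun a ha b _ => ?_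
  simp only [LinearMap.smul_apply, LinearMap.comp_apply]
  rw [opU_midCap_right hq hn h' k (by omega) ha, opU_right hq hn h k hk ha]
  simp only [map_sum, map_smul, Finset.smul_sum, smul_comm (qInt q (n' + 1))]
  refine Finset.sum_congr rfl fun p _ => ?_
  rcases Nat.lt_or_ge k p.1 with hp | hp
  · rw [gauss_of_lt hp]; simp
  · rw [midCap_dvec_right hn n' p.2 (by omega : a + p.1 ≤ m')]
    subst hk
    rw [show (m : ℤ) - a - ((n' + 1 : ℕ) : ℤ) + 1 + p.2 = m - a - n' + p.2 by push_cast; ring,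
      show (m : ℤ) + k - a - p.1 + p.2 = ((m + k : ℕ) : ℤ) - ((a + p.1 : ℕ) : ℤ) + p.2 by
        push_cast; ring]

/-- If no through line is left on the right, the middle cap is killed. -/
lemma opU_midCap_right_zero (hq : q ≠ 0) (hn : ∀ n : ℕ, 0 < n → qInt q n ≠ 0) {m n m' : ℕ}
    (h : m' + 0 = m + 1 + (n + 1)) : opU q h ∘ₗ midCap q m n = 0 := by
  refine hom_ext_vec_dvec hn fun a ha b _ => ?_
  refine smul_right_injective _ (hn (n + 1) n.succ_pos) ?_
  simp only [LinearMap.comp_apply]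
  rw [opU_midCap_right hq hn h (n + 1) (by omega) ha]
  rw [LinearMap.zero_apply, smul_zero]
  refine Finset.sum_eq_zero fun p _ => ?_
  rw [dvec_of_lt (Nat.succ_pos p.2), Nat.zero_sub]
  simp

end MiddleCap

/-! ### Nested caps and the eigenvalue on a multiplet -/

section NestedCaps

variable {F : Type*} [Field F] {q : F}

/-- The map `V(m) ⊗ V(n) → V(m + j) ⊗ V(n + j)` that `j` nested caps around the boundary of the two
blocks induce. -/
def nestedCaps (q : F) (m n : ℕ) : (j : ℕ) → VV F m n →ₗ[F] VV F (m + j) (n + j)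
  | 0 => LinearMap.id
  | j + 1 => midCap q (m + j) (n + j) ∘ₗ nestedCaps q m n j

lemma opU_right_nestedCaps (hq : q ≠ 0) (hn : ∀ n : ℕ, 0 < n → qInt q n ≠ 0) {m n m' n' k : ℕ}
    (h : m' + n' = m + n) (hk : m' = m + k) (j : ℕ) (h' : m' + j + (n' + j) = m + j + (n + j)) :
    opU q h' ∘ₗ nestedCaps q m n j =
      ((qFact q (n' + j) * qFact q n) / (qFact q n' * qFact q (n + j))) •
        (nestedCaps q m' n' j ∘ₗ opU q h) := by
  induction j with
  | zero =>
    simp only [nestedCaps, add_zero, LinearMap.comp_id, LinearMap.id_comp]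
    rw [mul_comm, div_self (mul_ne_zero (qFact_ne_zero hn _) (qFact_ne_zero hn _)), one_smul]
  | succ j ih =>
    have h1 : m' + j + (n' + j) = m + j + (n + j) := by omega
    have h2 : opU q h' ∘ₗ midCap q (m + j) (n + j) =
        (qInt q (n' + j + 1) / qInt q (n + j + 1)) • (midCap q (m' + j) (n' + j) ∘ₗ opU q h1) := by
      rw [div_eq_inv_mul, mul_smul, ← opU_midCap_right_succ hq hn h1 h' k (by omega), smul_smul,
        inv_mul_cancel₀ (hn _ (Nat.succ_pos _)), one_smul]
    simp only [nestedCaps]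
    rw [← LinearMap.comp_assoc, h2, LinearMap.smul_comp, LinearMap.comp_assoc, ih h1,
      LinearMap.comp_smul, smul_smul, LinearMap.comp_assoc]
    congr 1
    rw [← add_assoc n' j 1, ← add_assoc n j 1, qFact_succ, qFact_succ, div_mul_div_comm]
    congr 1 <;> ring

lemma opU_left_nestedCaps (hq : q ≠ 0) (hn : ∀ n : ℕ, 0 < n → qInt q n ≠ 0) {m n m' n' k : ℕ}
    (h : m' + n' = m + n) (hk : m = m' + k) (j : ℕ) (h' : m' + j + (n' + j) = m + j + (n + j)) :
    opU q h' ∘ₗ nestedCaps q m n j =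
      ((qFact q (m' + j) * qFact q m) / (qFact q m' * qFact q (m + j))) •
        (nestedCaps q m' n' j ∘ₗ opU q h) := by
  induction j with
  | zero =>
    simp only [nestedCaps, add_zero, LinearMap.comp_id, LinearMap.id_comp]
    rw [mul_comm, div_self (mul_ne_zero (qFact_ne_zero hn _) (qFact_ne_zero hn _)), one_smul]
  | succ j ih =>
    have h1 : m' + j + (n' + j) = m + j + (n + j) := by omega
    have h2 : opU q h' ∘ₗ midCap q (m + j) (n + j) =
        (qInt q (m' + j + 1) / qInt q (m + j + 1)) • (midCap q (m' + j) (n' + j) ∘ₗ opU q h1) := by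
      rw [div_eq_inv_mul, mul_smul, ← opU_midCap_left hq hn h1 h' k (by omega), smul_smul,
        inv_mul_cancel₀ (hn _ (Nat.succ_pos _)), one_smul]
    simp only [nestedCaps]
    rw [← LinearMap.comp_assoc, h2, LinearMap.smul_comp, LinearMap.comp_assoc, ih h1,
      LinearMap.comp_smul, smul_smul, LinearMap.comp_assoc]
    congr 1
    rw [← add_assoc m' j 1, ← add_assoc m j 1, qFact_succ, qFact_succ, div_mul_div_comm]
    congr 1 <;> ring

/-- If the right block of the target is shorter than the number of caps, everything is killed. -/
lemma opU_nestedCaps_eq_zero (hq : q ≠ 0) (hn : ∀ n : ℕ, 0 < n → qInt q n ≠ 0) {m n m' n' j : ℕ}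
    (h : m' + n' = m + j + (n + j)) (hj : n' < j) (hm : m + j ≤ m') :
    opU q h ∘ₗ nestedCaps q m n j = 0 := by
  induction j generalizing m' n' with
  | zero => omega
  | succ j ih =>
    simp only [nestedCaps]
    rw [← LinearMap.comp_assoc]
    rcases n' with _ | n'
    · have h0 := opU_midCap_right_zero hq hn (m := m + j) (n := n + j) h
      exact (congrArg (fun f => f ∘ₗ nestedCaps q m n j) h0).trans (LinearMap.zero_comp _)
    · obtain ⟨k, rfl⟩ := Nat.exists_eq_add_of_le hm
      obtain ⟨M, hM⟩ : ∃ M, m + (j + 1) + k = M + 1 := ⟨m + j + k, by ring⟩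
      generalize hM' : m + (j + 1) + k = M' at *
      subst hM
      have h1 : M + n' = m + j + (n + j) := by omega
      have h2 := opU_midCap_right_succ hq hn h1 h k (by omega)
      have h3 := congrArg (fun f => f ∘ₗ nestedCaps q m n j) h2
      simp only [LinearMap.smul_comp, LinearMap.comp_assoc, ih h1 (by omega) (by omega),
        LinearMap.comp_zero, smul_zero] at h3
      rw [LinearMap.comp_assoc]
      exact (smul_eq_zero.1 h3).resolve_left (hn _ (Nat.succ_pos _))

/-- The multiplet of total spin deviation `j`, embedded into `V(m + j) ⊗ V(n + j)`: the `m + n`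
through lines are symmetrized, split into two blocks, and `j` nested caps are inserted. -/
def multiplet (q : F) (m n j : ℕ) : V F (m + n) →ₗ[F] VV F (m + j) (n + j) :=
  nestedCaps q m n j ∘ₗ pairT q rfl ∘ₗ symTstar q (m + n)

/-- Without caps, `opU` only moves the boundary between the blocks of a symmetric tensor. -/
lemma opU_pairT_symTstar (hq : q ≠ 0) (hn : ∀ n : ℕ, 0 < n → qInt q n ≠ 0) {m n m' n' : ℕ}
    (h : m' + n' = m + n) :
    opU q h ∘ₗ pairT q rfl ∘ₗ symTstar q (m + n) = pairT q h ∘ₗ symTstar q (m + n) := by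
  refine LinearMap.ext fun x => ?_
  simp only [opU, LinearMap.comp_apply, pairTstar_pairT_symTstar hq hn]

lemma opU_pairT_symTstar' (hq : q ≠ 0) (hn : ∀ n : ℕ, 0 < n → qInt q n ≠ 0) {m n m' n' : ℕ}
    (h : m' + n' = m + n) :
    opU q h.symm ∘ₗ pairT q h ∘ₗ symTstar q (m + n) = pairT q rfl ∘ₗ symTstar q (m + n) := by
  have key : ∀ (N : ℕ) (h1 : m' + n' = N) (h2 : m + n = N) (h3 : m + n = m' + n'),
      opU q h3 ∘ₗ pairT q h1 ∘ₗ symTstar q N = pairT q h2 ∘ₗ symTstar q N := by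
    rintro N rfl h2 h3
    exact opU_pairT_symTstar hq hn h3
  exact key _ h rfl h.symm

/-- The operator is a composite of two `opU`. Each of them commutes with the nested caps up to a
scalar, and they cancel on symmetric tensors; `λ_j` is the product of the two scalars. -/
lemma cascade_multiplet (hq : q ≠ 0) (hn : ∀ n : ℕ, 0 < n → qInt q n ≠ 0) (m n j k : ℕ)
    (hk : k ≤ n + j) : cascade q (m + j) (n + j) k hk ∘ₗ multiplet q m n j =
      cascadeEigenvalue q (m + j) (n + j) k j • multiplet q m n j := by
  have h0 : m + j + k + (n + j - k) = m + j + (n + j) := by omega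
  have hc : cascade q (m + j) (n + j) k hk = opU q h0.symm ∘ₗ opU q h0 := rfl
  rw [hc, multiplet, cascadeEigenvalue]
  change opU q h0.symm ∘ₗ (opU q h0 ∘ₗ nestedCaps q m n j) ∘ₗ
    pairT q rfl ∘ₗ symTstar q (m + n) = _
  split_ifs with h
  · obtain ⟨n', rfl⟩ : ∃ n', n = n' + k := ⟨n - k, by omega⟩
    have key : ∀ (M N : ℕ) (hM : M = m + k + j) (hN : N = n' + j)
        (h0 : M + N = m + j + (n' + k + j)),
        opU q h0.symm ∘ₗ (opU q h0 ∘ₗ nestedCaps q m (n' + k) j) ∘ₗ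
          pairT q rfl ∘ₗ symTstar q (m + (n' + k)) =
        ((qFact q (m + j + k - j) * qFact q (m + j) * qFact q (n' + k + j - j) *
          qFact q (n' + k + j - k)) / (qFact q (m + j - j) * qFact q (m + j + k) *
          qFact q (n' + k + j - j - k) * qFact q (n' + k + j))) •
        nestedCaps q m (n' + k) j ∘ₗ pairT q rfl ∘ₗ symTstar q (m + (n' + k)) := by
      rintro _ _ rfl rfl h0
      have h1 : m + k + n' = m + (n' + k) := by ring
      rw [opU_right_nestedCaps hq hn h1 rfl j h0, LinearMap.smul_comp, LinearMap.comp_smul,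
        LinearMap.comp_assoc, opU_pairT_symTstar hq hn h1, ← LinearMap.comp_assoc,
        opU_left_nestedCaps hq hn h1.symm rfl j h0.symm, LinearMap.smul_comp, LinearMap.comp_assoc,
        opU_pairT_symTstar' hq hn h1, smul_smul]
      congr 1
      rw [show m + j + k - j = m + k by omega, show n' + k + j - j = n' + k by omega,
        show n' + k + j - k = n' + j by omega, show m + j - j = m by omega,
        show n' + k - k = n' by omega, show m + j + k = m + k + j by omega, div_mul_div_comm]
      congr 1 <;> ring
    exact key _ _ (by omega) (by omega) h0
  · rw [opU_nestedCaps_eq_zero hq hn h0 (by omega) (by omega)]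
    simp

end NestedCaps

/-! ### Cap diagrams below two symmetrizers -/

section CapDiagrams

variable {F : Type*} [Field F] {q : F}

lemma pairT_word_append {m n N : ℕ} (h : m + n = N) {l : List (Fin 2)} (hl : l.length = m)
    (l' : List (Fin 2)) :
    pairT q h (word F N (l ++ l')) = symT q m (word F m l) ⊗ₜ symT q n (word F n l') := by
  rw [← join_word h hl, pairT_join]

lemma insertCap_word {L : ℕ} (i : Fin (L + 1)) {x y : List (Fin 2)} (hx : x.length = i)
    (hy : x.length + y.length = L) :
    insertCap q i (word F L (x ++ y)) =
      word F (L + 2) (x ++ 1 :: 0 :: y) - q⁻¹ • word F (L + 2) (x ++ 0 :: 1 :: y) := by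
  have hl : (x ++ y).length = L := by simpa using hy
  have key : ∀ a b : Fin 2, tensBasis F (L + 2)
      (insertPair i a b fun i => (x ++ y).getD i 0) = word F (L + 2) (x ++ a :: b :: y) := by
    intro a b
    rw [← word_ofFn, ofFn_insertPair, ofFn_getD hl, ← hx, List.take_left', List.drop_left'] <;> rfl
  rw [word, insertCap, Module.Basis.constr_basis, key, key]

/-- A symmetrizer kills a cap between two of its factors. -/
lemma symT_cap (hq : q ≠ 0) {n : ℕ} {x y : List (Fin 2)} (h : x.length + (y.length + 2) = n) :
    symT q n (word F n (x ++ 1 :: 0 :: y)) = q⁻¹ • symT q n (word F n (x ++ 0 :: 1 :: y)) := by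
  rw [symT_word (by simpa using h), symT_word (by simpa using h), smul_smul]
  have h1 : pairCount 0 1 (x ++ 0 :: 1 :: y) = pairCount 0 1 (x ++ 1 :: 0 :: y) + 1 := by
    simp only [pairCount_append, pairCount, List.count_cons]
    simp
    ring
  rw [h1, pow_succ']
  have h2 : (x ++ 0 :: 1 :: y).count 1 = (x ++ 1 :: 0 :: y).count 1 := by
    simp [List.count_append]
  rw [h2, inv_mul_cancel_left₀ hq]

lemma exists_append {L : ℕ} (l : List (Fin 2)) (hl : l.length = L) {i : ℕ} (hi : i ≤ L) :
    ∃ x y : List (Fin 2), l = x ++ y ∧ x.length = i ∧ x.length + y.length = L :=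
  ⟨l.take i, l.drop i, (List.take_append_drop i l).symm, by simp; omega, by simp; omega⟩

/-- Only the cap that joins the two blocks survives the two symmetrizers. -/
lemma pairT_insertCap_of_ne (hq : q ≠ 0) {m n L : ℕ} (h : m + n = L + 2) (i : Fin (L + 1))
    (hi : (i : ℕ) + 1 ≠ m) : pairT q h ∘ₗ insertCap q i = 0 := by
  refine hom_ext_word fun l hl => ?_
  have hiL := i.2
  obtain ⟨x, y, rfl, hx, hy⟩ := exists_append l hl (Nat.le_of_lt_succ i.2)
  rw [LinearMap.comp_apply, insertCap_word i hx hy, map_sub, map_smul, LinearMap.zero_apply]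
  rcases Nat.lt_or_ge ((i : ℕ) + 1) m with him | him
  · obtain ⟨y, z, rfl, hy', hz⟩ := exists_append y rfl (by omega : m - (i + 2) ≤ y.length)
    rw [List.length_append] at hy
    have e : ∀ a b : Fin 2, x ++ a :: b :: (y ++ z) = (x ++ a :: b :: y) ++ z := by simp
    rw [e, e, pairT_word_append h (by simp; omega), pairT_word_append h (by simp; omega),
      symT_cap hq (by omega),
      ← TensorProduct.smul_tmul', sub_self]
  · obtain ⟨x, z, rfl, hx', hz⟩ := exists_append x rfl (by omega : m ≤ x.length)
    rw [List.length_append] at hy hx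
    rw [List.append_assoc, List.append_assoc, pairT_word_append h (by omega),
      pairT_word_append h (by omega), symT_cap hq (by omega),
      TensorProduct.tmul_smul, sub_self]

lemma pairT_insertCap_middle {m n L : ℕ} (h : m + n = L) (h' : m + 1 + (n + 1) = L + 2)
    (i : Fin (L + 1)) (hi : (i : ℕ) = m) :
    pairT q h' ∘ₗ insertCap q i = midCap q m n ∘ₗ pairT q h := by
  refine hom_ext_word fun l hl => ?_
  obtain ⟨x, y, rfl, hx, hy⟩ := exists_append l hl (Nat.le_of_lt_succ i.2)
  have hxm : x.length = m := by omega
  have hyn : y.length = n := by omega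
  rw [LinearMap.comp_apply, LinearMap.comp_apply, insertCap_word i hx hy, map_sub, map_smul,
    pairT_word_append h hxm]
  have e : ∀ a b : Fin 2, x ++ a :: b :: y = (x ++ [a]) ++ (b :: y) := by simp
  have h0 : ((x.count 0 : ℕ) : ℤ) = m - x.count 1 := by
    have := count_zero_add_count_one x
    omega
  rw [e, e, pairT_word_append h' (by simpa using hxm), pairT_word_append h' (by simpa using hxm),
    symT_word (l := x ++ [1]) (by simpa using hxm), symT_word (l := x ++ [0]) (by simpa using hxm),
    symT_word (l := 0 :: y) (by simpa using hyn), symT_word (l := 1 :: y) (by simpa using hyn),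
    symT_word hxm, symT_word hyn, TensorProduct.smul_tmul_smul, TensorProduct.smul_tmul_smul,
    TensorProduct.smul_tmul_smul, map_smul,
    midCap_vec (hxm ▸ count_one_le x) (hyn ▸ count_one_le y), ← h0, smul_sub, smul_smul, smul_smul,
    smul_smul]
  norm_cast
  simp only [pairCount_append, pairCount, List.count_append, List.count_cons]
  simp
  congr 2 <;> ring

lemma IsCapDiagram.length {r k L : ℕ} {d : Tens F r →ₗ[F] Tens F L} (hd : IsCapDiagram q r k L d) :
    L = r + 2 * k := by
  induction hd with
  | nil => simp
  | cap i _ ih => omega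

/-- With fewer than `k` factors in one of the blocks, some of the `k` caps does not cross the
boundary of the two blocks. -/
lemma IsCapDiagram.pairT_eq_zero (hq : q ≠ 0) {r k L : ℕ} {d : Tens F r →ₗ[F] Tens F L}
    (hd : IsCapDiagram q r k L d) {m n : ℕ} (h : m + n = L) (hk : m < k ∨ n < k) :
    pairT q h ∘ₗ d = 0 := by
  induction hd generalizing m n with
  | nil => omega
  | @cap k L d i hd ih =>
    rw [← LinearMap.comp_assoc]
    by_cases hi : (i : ℕ) + 1 = m
    · obtain ⟨n, rfl⟩ : ∃ n', n = n' + 1 := ⟨n - 1, by have := i.2; omega⟩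
      subst hi
      rw [pairT_insertCap_middle (by omega : (i : ℕ) + n = L) h i rfl, LinearMap.comp_assoc,
        ih _ (by omega), LinearMap.comp_zero]
    · rw [pairT_insertCap_of_ne hq h i hi, LinearMap.zero_comp]

/-- A cap diagram that the two symmetrizers do not kill consists of nested caps around the
boundary of the two blocks. -/
lemma IsCapDiagram.pairT_eq (hq : q ≠ 0) {r k L : ℕ} {d : Tens F r →ₗ[F] Tens F L}
    (hd : IsCapDiagram q r k L d) {m n : ℕ} (h : m + k + (n + k) = L) (h' : m + n = r) :
    pairT q h ∘ₗ d = 0 ∨ pairT q h ∘ₗ d = nestedCaps q m n k ∘ₗ pairT q h' := by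
  induction hd with
  | nil => right; rfl
  | @cap k L d i hd ih =>
    rw [← LinearMap.comp_assoc]
    by_cases hi : (i : ℕ) = m + k
    · rw [pairT_insertCap_middle (by omega : m + k + (n + k) = L) h i hi, LinearMap.comp_assoc]
      rcases ih (by omega) with h0 | h0
      · left; rw [h0, LinearMap.comp_zero]
      · right; rw [h0]; rfl
    · left
      rw [pairT_insertCap_of_ne hq h i (by omega), LinearMap.zero_comp]

lemma exists_isCapDiagram_nestedCaps (m n j : ℕ) : ∃ (L : ℕ) (h : m + j + (n + j) = L)
    (d : Tens F (m + n) →ₗ[F] Tens F L), IsCapDiagram q (m + n) j L d ∧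
      pairT q h ∘ₗ d = nestedCaps q m n j ∘ₗ pairT q rfl := by
  induction j with
  | zero => exact ⟨_, rfl, _, .nil, rfl⟩
  | succ j ih =>
    obtain ⟨L, h, d, hd, e⟩ := ih
    refine ⟨L + 2, by omega, _, .cap ⟨m + j, by omega⟩ hd, ?_⟩
    rw [← LinearMap.comp_assoc, pairT_insertCap_middle h _ _ rfl, LinearMap.comp_assoc, e]
    rfl

lemma pairT_tensBasis {m n N : ℕ} (h : m + n = N) (w : Fin N → Fin 2) :
    ∃ (c : F) (a b : ℕ), a ≤ m ∧ b ≤ n ∧ a + b = downs w ∧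
      pairT q h (tensBasis F N w) = c • vec F m a ⊗ₜ vec F n b := by
  obtain ⟨x, y, e, hx, hy⟩ := exists_append (List.ofFn w) List.length_ofFn (by omega : m ≤ N)
  have hyn : y.length = n := by omega
  refine ⟨q ^ pairCount 0 1 x * q ^ pairCount 0 1 y, x.count 1, y.count 1, hx ▸ count_one_le x,
    hyn ▸ count_one_le y, ?_, ?_⟩
  · rw [downs_eq, e, List.count_append]
  · rw [← word_ofFn, e, pairT_word_append h hx, symT_word hx, symT_word hyn,
      TensorProduct.smul_tmul_smul]

lemma pairT_tensBasis_zero {m n N : ℕ} (h : m + n = N) :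
    pairT q h (tensBasis F N fun _ => 0) = vec F m 0 ⊗ₜ vec F n 0 := by
  have e : List.ofFn (fun _ : Fin N => (0 : Fin 2)) = List.replicate m 0 ++ List.replicate n 0 := by
    subst h
    rw [← List.replicate_add, ← List.ofFn_const]
  have hp : ∀ k, pairCount 0 1 (List.replicate k 0) = 0 := by
    intro k
    induction k with
    | zero => rfl
    | succ k ih => simp [List.replicate_succ, pairCount, ih, List.count_replicate]
  rw [← word_ofFn, e, pairT_word_append h (by simp), symT_word (by simp),
    symT_word (by simp), hp, hp]
  simp [List.count_replicate]

lemma eq_zero_of_downs {n : ℕ} {w : Fin n → Fin 2} (h : downs w = 0) : w = fun _ => 0 := by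
  funext i
  have hi : w i ≠ 1 := fun hi => by
    have := Finset.card_eq_zero.1 h
    exact Finset.notMem_empty i (this ▸ Finset.mem_filter.2 ⟨Finset.mem_univ i, hi⟩)
  omega

end CapDiagrams

/-! ### Coordinates and injectivity -/

section Coordinates

variable {F : Type*} [Field F] {q : F}

/-- The coordinate at `v^(m - 2a) ⊗ v^(n - 2b)` of a vector of `V(m) ⊗ V(n)`; it is `0` unless
`a ≤ m` and `b ≤ n`. -/
def coord (F : Type*) [Field F] (m n a b : ℕ) : VV F m n →ₗ[F] F :=
  TensorProduct.lift (onBasis m fun a' => onBasis n fun b' => if a' = a ∧ b' = b then 1 else 0)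

lemma coord_vec {m n a' b' : ℕ} (ha : a' ≤ m) (hb : b' ≤ n) (a b : ℕ) :
    coord F m n a b (vec F m a' ⊗ₜ vec F n b') = if a' = a ∧ b' = b then 1 else 0 := by
  rw [coord, TensorProduct.lift.tmul, onBasis_vec _ ha, onBasis_vec _ hb]

lemma sum_coord {m n : ℕ} (x : VV F m n) :
    x = ∑ a ∈ Finset.range (m + 1), ∑ b ∈ Finset.range (n + 1),
      coord F m n a b x • vec F m a ⊗ₜ[F] vec F n b := by
  have : LinearMap.id = ∑ a ∈ Finset.range (m + 1), ∑ b ∈ Finset.range (n + 1),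
      (coord F m n a b).smulRight (vec F m a ⊗ₜ[F] vec F n b) := by
    refine hom_ext_vec_vec fun a ha b hb => ?_
    simp only [LinearMap.id_apply, LinearMap.sum_apply, LinearMap.smulRight_apply, coord_vec ha hb]
    rw [Finset.sum_eq_single a, Finset.sum_eq_single b]
    · simp
    · intro b' _ h
      simp [h.symm]
    · intro h
      exact absurd (Finset.mem_range.2 (by omega)) h
    · intro a' _ h
      simp [h.symm]
    · intro h
      exact absurd (Finset.mem_range.2 (by omega)) h
  have h := LinearMap.congr_fun this x
  simpa only [LinearMap.id_apply, LinearMap.sum_apply, LinearMap.smulRight_apply] using h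

lemma eq_zero_of_coord {m n : ℕ} {x : VV F m n} (h : ∀ a b, coord F m n a b x = 0) : x = 0 := by
  rw [sum_coord x]
  simp [h]

lemma coord_midCap_zero_left (m n b : ℕ) (x : VV F m n) :
    coord F (m + 1) (n + 1) 0 (b + 1) (midCap q m n x) = -q⁻¹ * coord F m n 0 b x := by
  have : coord F (m + 1) (n + 1) 0 (b + 1) ∘ₗ midCap q m n = -q⁻¹ • coord F m n 0 b :=
    hom_ext_vec_vec fun a' ha b' hb => by
      rw [LinearMap.comp_apply, midCap_vec ha hb, map_sub, map_smul, map_smul,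
        coord_vec (by omega) (by omega), coord_vec (by omega) (by omega), LinearMap.smul_apply,
        coord_vec ha hb]
      by_cases h : a' = 0 ∧ b' = b <;> simp [h]
  exact LinearMap.congr_fun this x

lemma coord_midCap_zero_right (m n a : ℕ) (x : VV F m n) :
    coord F (m + 1) (n + 1) (a + 1) 0 (midCap q m n x) =
      q ^ ((m : ℤ) - a) * coord F m n a 0 x := by
  have : coord F (m + 1) (n + 1) (a + 1) 0 ∘ₗ midCap q m n =
      q ^ ((m : ℤ) - a) • coord F m n a 0 :=
    hom_ext_vec_vec fun a' ha b' hb => by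
      rw [LinearMap.comp_apply, midCap_vec ha hb, map_sub, map_smul, map_smul,
        coord_vec (by omega) (by omega), coord_vec (by omega) (by omega), LinearMap.smul_apply,
        coord_vec ha hb]
      by_cases h : a' = a ∧ b' = 0
      · obtain ⟨rfl, rfl⟩ := h
        simp
      · simp [h]
  exact LinearMap.congr_fun this x

/-- The two-term recursion by which a vector in the kernel of `midCap` vanishes coordinate by
coordinate. -/
lemma coord_midCap_succ (m n a b : ℕ) (x : VV F m n) :
    coord F (m + 1) (n + 1) (a + 1) (b + 1) (midCap q m n x) =
      q ^ ((m : ℤ) - a + (b + 1)) * coord F m n a (b + 1) x - q⁻¹ * coord F m n (a + 1) b x := by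
  have : coord F (m + 1) (n + 1) (a + 1) (b + 1) ∘ₗ midCap q m n =
      q ^ ((m : ℤ) - a + (b + 1)) • coord F m n a (b + 1) - q⁻¹ • coord F m n (a + 1) b :=
    hom_ext_vec_vec fun a' ha b' hb => by
      rw [LinearMap.comp_apply, midCap_vec ha hb, map_sub, map_smul, map_smul,
        coord_vec (by omega) (by omega), coord_vec (by omega) (by omega), LinearMap.sub_apply,
        LinearMap.smul_apply, LinearMap.smul_apply, coord_vec ha hb, coord_vec ha hb]
      simp only [add_left_inj]
      congr 1
      by_cases h : a' = a ∧ b' = b + 1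
      · obtain ⟨rfl, rfl⟩ := h
        push_cast
        rfl
      · simp [h]
  exact LinearMap.congr_fun this x

lemma midCap_injective (hq : q ≠ 0) (m n : ℕ) : Function.Injective (midCap q m n) := by
  rw [injective_iff_map_eq_zero]
  intro x hx
  have h : ∀ a b, coord F m n a b x = 0 := by
    intro a
    induction a with
    | zero =>
      intro b
      have := coord_midCap_zero_left (q := q) m n b x
      rw [hx, map_zero] at this
      exact (mul_eq_zero.1 this.symm).resolve_left (neg_ne_zero.2 (inv_ne_zero hq))
    | succ a ih =>
      intro b
      have := coord_midCap_succ (q := q) m n a b x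
      rw [hx, map_zero, ih, mul_zero, zero_sub] at this
      exact (mul_eq_zero.1 (neg_eq_zero.1 this.symm)).resolve_left (inv_ne_zero hq)
  exact eq_zero_of_coord h

lemma nestedCaps_injective (hq : q ≠ 0) (m n j : ℕ) :
    Function.Injective (nestedCaps q m n j) := by
  induction j with
  | zero => exact Function.injective_id
  | succ j ih => exact (midCap_injective hq _ _).comp ih

lemma multiplet_injective (hq : q ≠ 0) (hn : ∀ n : ℕ, 0 < n → qInt q n ≠ 0) (m n j : ℕ) :
    Function.Injective (multiplet q m n j) := by
  refine (nestedCaps_injective hq m n j).comp ?_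
  refine Function.LeftInverse.injective (g := symT q (m + n) ∘ pairTstar q rfl) fun x => ?_
  simp only [Function.comp_apply]
  exact (congrArg _ (pairTstar_pairT_symTstar hq hn rfl x)).trans (symT_symTstar hq hn _ x)

lemma coord_nestedCaps_zero_left (m n j b : ℕ) (x : VV F m n) :
    coord F (m + j) (n + j) 0 (b + j) (nestedCaps q m n j x) =
      (-q⁻¹) ^ j * coord F m n 0 b x := by
  induction j with
  | zero => simp [nestedCaps]
  | succ j ih =>
    simp only [nestedCaps, LinearMap.comp_apply]
    exact (coord_midCap_zero_left (m + j) (n + j) (b + j) _).trans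
      (by rw [ih, pow_succ', mul_assoc])

lemma coord_nestedCaps_zero_right (hq : q ≠ 0) (m n j a : ℕ) : ∃ c : F, c ≠ 0 ∧
    ∀ x : VV F m n, coord F (m + j) (n + j) (a + j) 0 (nestedCaps q m n j x) =
      c * coord F m n a 0 x := by
  induction j with
  | zero => exact ⟨1, one_ne_zero, fun x => by simp [nestedCaps]⟩
  | succ j ih =>
    obtain ⟨c, hc, h⟩ := ih
    refine ⟨_, mul_ne_zero (zpow_ne_zero (((m + j : ℕ) : ℤ) - (a + j : ℕ)) hq) hc, fun x => ?_⟩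
    simp only [nestedCaps, LinearMap.comp_apply]
    exact (coord_midCap_zero_right (m + j) (n + j) (a + j) _).trans (by rw [h, mul_assoc])

lemma coord_of_mem_weightSpace {m n j a b : ℕ} (h : a + b ≠ j) {x : VV F m n}
    (hx : x ∈ weightSpace F m n j) : coord F m n a b x = 0 := by
  induction hx using Submodule.span_induction with
  | mem x hx =>
    obtain ⟨a', b', ha, hb, hab, rfl⟩ := hx
    rw [coord_vec ha hb, if_neg (by omega)]
  | zero => simp
  | add x y _ _ hx hy => rw [map_add, hx, hy, add_zero]
  | smul c x _ hx => rw [map_smul, hx, smul_zero]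

lemma vec_mem_weightSpace {m n j a b : ℕ} (h : a + b = j) :
    vec F m a ⊗ₜ vec F n b ∈ weightSpace F m n j := by
  rcases Nat.lt_or_ge m a with ha | ha
  · rw [vec_of_lt ha, TensorProduct.zero_tmul]; exact zero_mem _
  rcases Nat.lt_or_ge n b with hb | hb
  · rw [vec_of_lt hb, TensorProduct.tmul_zero]; exact zero_mem _
  exact Submodule.subset_span ⟨a, b, ha, hb, h, rfl⟩

lemma nestedCaps_mem_weightSpace {m n i : ℕ} {x : VV F m n} (hx : x ∈ weightSpace F m n i) (j : ℕ) :
    nestedCaps q m n j x ∈ weightSpace F (m + j) (n + j) (i + j) := by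
  induction j with
  | zero => exact hx
  | succ j ih =>
    simp only [nestedCaps, LinearMap.comp_apply]
    generalize nestedCaps q m n j x = y at ih
    induction ih using Submodule.span_induction with
    | mem y hy =>
      obtain ⟨a, b, ha, hb, hab, rfl⟩ := hy
      rw [midCap_vec ha hb]
      exact sub_mem (Submodule.smul_mem _ _ (vec_mem_weightSpace (by omega)))
        (Submodule.smul_mem _ _ (vec_mem_weightSpace (by omega)))
    | zero => rw [map_zero]; exact zero_mem _
    | add x y _ _ hx hy => rw [map_add]; exact add_mem hx hy
    | smul c x _ hx => rw [map_smul]; exact Submodule.smul_mem _ _ hx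

end Coordinates

/-! ### Equivariance, highest weight vectors and sectors -/

section Equivariance

variable {F : Type*} [Field F] {q : F}

lemma coE_vec {m n a b : ℕ} (ha : a ≤ m) (hb : b ≤ n) :
    coE q m n (vec F m a ⊗ₜ vec F n b) = qInt q a • vec F m (a - 1) ⊗ₜ[F] vec F n b +
      (q ^ ((m : ℤ) - 2 * a) * qInt q b) • vec F m a ⊗ₜ[F] vec F n (b - 1) := by
  rw [coE, LinearMap.add_apply, TensorProduct.map_tmul, TensorProduct.map_tmul, opE, opE, opK,
    onBasis_vec _ ha, onBasis_vec _ ha, onBasis_vec _ hb, LinearMap.id_apply,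
    ← TensorProduct.smul_tmul', TensorProduct.smul_tmul_smul]

lemma coF_vec {m n a b : ℕ} (ha : a ≤ m) (hb : b ≤ n) :
    coF q m n (vec F m a ⊗ₜ vec F n b) =
      (qInt q (m - a) * q ^ (-((n : ℤ) - 2 * b))) • vec F m (a + 1) ⊗ₜ[F] vec F n b +
      qInt q (n - b) • vec F m a ⊗ₜ[F] vec F n (b + 1) := by
  rw [coF, LinearMap.add_apply, TensorProduct.map_tmul, TensorProduct.map_tmul, opF, opF, opKinv,
    onBasis_vec _ ha, onBasis_vec _ hb, onBasis_vec _ hb, LinearMap.id_apply,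
    TensorProduct.smul_tmul_smul, TensorProduct.tmul_smul]

lemma coE_midCap (hq : q ≠ 0) (m n : ℕ) :
    coE q (m + 1) (n + 1) ∘ₗ midCap q m n = midCap q m n ∘ₗ coE q m n := by
  refine hom_ext_vec_vec fun a ha b hb => ?_
  rw [LinearMap.comp_apply, LinearMap.comp_apply, midCap_vec ha hb, map_sub, map_smul, map_smul,
    coE_vec (by omega) (by omega), coE_vec (by omega) (by omega), coE_vec ha hb, map_add, map_smul,
    map_smul, midCap_vec (by omega) hb, midCap_vec ha (by omega)]
  have h1 : qInt q (a + 1) = q * qInt q a + (q ^ a)⁻¹ := by simpa using qInt_add hq a 1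
  have h2 : qInt q (b + 1) = q⁻¹ * qInt q b + q ^ b := by simpa using qInt_add' hq b 1
  rcases a with _ | a <;> rcases b with _ | b <;>
    simp only [h1, h2, qInt_zero, zero_smul, add_zero, mul_zero, Nat.add_sub_cancel] <;>
    match_scalars <;>
    first
    | ring1
    | simp only [two_mul, zpow_add₀ hq, zpow_sub₀ hq, zpow_natCast, zpow_one, zpow_zero,
        pow_succ]
      field_simp
      try ring1

lemma coF_midCap (hq : q ≠ 0) (m n : ℕ) :
    coF q (m + 1) (n + 1) ∘ₗ midCap q m n = midCap q m n ∘ₗ coF q m n := by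
  refine hom_ext_vec_vec fun a ha b hb => ?_
  have hA : qInt q (m - a) • midCap q m n (vec F m (a + 1) ⊗ₜ vec F n b) =
      qInt q (m - a) • (q ^ ((m : ℤ) - (a + 1 : ℕ) + b) •
        vec F (m + 1) (a + 1 + 1) ⊗ₜ[F] vec F (n + 1) b -
        q⁻¹ • vec F (m + 1) (a + 1) ⊗ₜ[F] vec F (n + 1) (b + 1)) := by
    rcases Nat.eq_or_lt_of_le ha with h | h
    · rw [h]; simp
    · rw [midCap_vec h hb]
  have hB : qInt q (n - b) • midCap q m n (vec F m a ⊗ₜ vec F n (b + 1)) =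
      qInt q (n - b) • (q ^ ((m : ℤ) - a + (b + 1 : ℕ)) •
        vec F (m + 1) (a + 1) ⊗ₜ[F] vec F (n + 1) (b + 1) -
        q⁻¹ • vec F (m + 1) a ⊗ₜ[F] vec F (n + 1) (b + 1 + 1)) := by
    rcases Nat.eq_or_lt_of_le hb with h | h
    · rw [h]; simp
    · rw [midCap_vec ha h]
  rw [LinearMap.comp_apply, LinearMap.comp_apply, midCap_vec ha hb, map_sub, map_smul, map_smul,
    coF_vec (by omega) (by omega), coF_vec (by omega) (by omega), coF_vec ha hb, map_add, map_smul,
    map_smul, hB, mul_comm (qInt q (m - a)), mul_smul _ (qInt q (m - a)) (midCap _ _ _ _), hA]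
  obtain ⟨X, rfl⟩ := Nat.exists_eq_add_of_le ha
  obtain ⟨Y, rfl⟩ := Nat.exists_eq_add_of_le hb
  have h1 : qInt q (X + 1) = q⁻¹ * qInt q X + q ^ X := by simpa using qInt_add' hq X 1
  have h2 : qInt q (Y + 1) = q * qInt q Y + (q ^ Y)⁻¹ := by simpa using qInt_add hq Y 1
  rw [show a + X + 1 - (a + 1) = X by omega, show b + Y + 1 - (b + 1) = Y by omega,
    show a + X + 1 - a = X + 1 by omega, show b + Y + 1 - b = Y + 1 by omega,
    Nat.add_sub_cancel_left, Nat.add_sub_cancel_left]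
  simp only [h1, h2]
  match_scalars <;>
    first
    | ring1
    | simp only [two_mul, neg_sub, zpow_add₀ hq, zpow_sub₀ hq, zpow_natCast, zpow_one]
      field_simp
      try ring1

lemma opF_dvec (hn : ∀ n : ℕ, 0 < n → qInt q n ≠ 0) {n a : ℕ} (ha : a ≤ n) :
    opF q n (dvec q n a) = qInt q (a + 1) • dvec q n (a + 1) := by
  rw [dvec, map_smul, opF, onBasis_vec _ ha, dvec, smul_smul, smul_smul, qInt_mul_gauss_succ hn,
    mul_comm]

lemma coF_dvec (hn : ∀ n : ℕ, 0 < n → qInt q n ≠ 0) {m n a b : ℕ} (ha : a ≤ m) (hb : b ≤ n) :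
    coF q m n (dvec q m a ⊗ₜ dvec q n b) =
      (qInt q (a + 1) * q ^ (-((n : ℤ) - 2 * b))) • dvec q m (a + 1) ⊗ₜ[F] dvec q n b +
      qInt q (b + 1) • dvec q m a ⊗ₜ[F] dvec q n (b + 1) := by
  have h : opKinv q n (dvec q n b) = q ^ (-((n : ℤ) - 2 * b)) • dvec q n b := by
    rw [dvec, map_smul, opKinv, onBasis_vec _ hb, smul_comm]
  rw [coF, LinearMap.add_apply, TensorProduct.map_tmul, TensorProduct.map_tmul, opF_dvec hn ha,
    opF_dvec hn hb, h, LinearMap.id_apply, TensorProduct.smul_tmul_smul, TensorProduct.tmul_smul]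

lemma coF_pairT_symTstar (hq : q ≠ 0) (hn : ∀ n : ℕ, 0 < n → qInt q n ≠ 0) (m n : ℕ) :
    coF q m n ∘ₗ pairT q rfl ∘ₗ symTstar q (m + n) =
      (pairT q rfl ∘ₗ symTstar q (m + n)) ∘ₗ opF q (m + n) := by
  refine hom_ext_dvec hn fun c hc => ?_
  simp only [LinearMap.comp_apply]
  rw [opF_dvec hn hc, map_smul, map_smul, symTstar_dvec hn, symTstar_dvec hn, pairT_symVec hq hn,
    pairT_symVec hq hn, map_sum]
  have key : ∀ p ∈ Finset.HasAntidiagonal.antidiagonal c,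
      coF q m n (q ^ (-(p.1 : ℤ) * (n - p.2)) • dvec q m p.1 ⊗ₜ[F] dvec q n p.2) =
      (q ^ (-(p.1 : ℤ) * (n - p.2)) * (qInt q (p.1 + 1) * q ^ (-((n : ℤ) - 2 * p.2)))) •
        dvec q m (p.1 + 1) ⊗ₜ[F] dvec q n p.2 +
      (q ^ (-(p.1 : ℤ) * (n - p.2)) * qInt q (p.2 + 1)) •
        dvec q m p.1 ⊗ₜ[F] dvec q n (p.2 + 1) := by
    intro p _
    rw [map_smul]
    rcases Nat.lt_or_ge m p.1 with h1 | h1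
    · rw [dvec_of_lt h1, dvec_of_lt (by omega : m < p.1 + 1)]; simp
    rcases Nat.lt_or_ge n p.2 with h2 | h2
    · rw [dvec_of_lt h2, dvec_of_lt (by omega : n < p.2 + 1)]; simp
    rw [coF_dvec hn h1 h2, smul_add, smul_smul, smul_smul]
  rw [Finset.sum_congr rfl key, Finset.sum_add_distrib, Finset.smul_sum]
  -- both sums on the left are sums over the antidiagonal of `c + 1`, with a vanishing end term
  have h1 := Finset.Nat.sum_antidiagonal_succ (n := c) (f := fun p : ℕ × ℕ =>
    (q ^ (-((p.1 : ℤ) - 1) * (n - p.2)) * (qInt q p.1 * q ^ (-((n : ℤ) - 2 * p.2)))) •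
      dvec q m p.1 ⊗ₜ[F] dvec q n p.2)
  have h2 := Finset.Nat.sum_antidiagonal_succ' (n := c) (f := fun p : ℕ × ℕ =>
    (q ^ (-(p.1 : ℤ) * (n - (p.2 - 1))) * qInt q p.2) • dvec q m p.1 ⊗ₜ[F] dvec q n p.2)
  simp only [qInt_zero, mul_zero, zero_mul, zero_smul, zero_add, Nat.cast_add, Nat.cast_one,
    add_sub_cancel_right] at h1 h2
  rw [← h1, ← h2, ← Finset.sum_add_distrib]
  refine Finset.sum_congr rfl ?_
  rintro ⟨i, j⟩ hp
  rw [Finset.HasAntidiagonal.mem_antidiagonal] at hp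
  dsimp only at hp ⊢
  rw [← add_smul, smul_smul, ← hp, qInt_add hq i j]
  congr 1
  have e1 : q ^ (-((i : ℤ) - 1) * (n - j)) * q ^ (-((n : ℤ) - 2 * j)) =
      q ^ (-(i : ℤ) * (n - j)) * q ^ (j : ℤ) := by
    rw [← zpow_add₀ hq, ← zpow_add₀ hq]
    congr 1
    ring
  have e2 : q ^ (-(i : ℤ) * (n - (j - 1))) = q ^ (-(i : ℤ) * (n - j)) * q ^ (-(i : ℤ)) := by
    rw [← zpow_add₀ hq]
    congr 1
    ring
  linear_combination qInt q i * e1 + qInt q j * e2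

lemma coE_nestedCaps (hq : q ≠ 0) (m n j : ℕ) :
    coE q (m + j) (n + j) ∘ₗ nestedCaps q m n j = nestedCaps q m n j ∘ₗ coE q m n := by
  induction j with
  | zero => rfl
  | succ j ih =>
    simp only [nestedCaps]
    rw [LinearMap.comp_assoc, ← ih, ← LinearMap.comp_assoc, ← LinearMap.comp_assoc,
      ← coE_midCap hq]
    rfl

lemma coF_nestedCaps (hq : q ≠ 0) (m n j : ℕ) :
    coF q (m + j) (n + j) ∘ₗ nestedCaps q m n j = nestedCaps q m n j ∘ₗ coF q m n := by
  induction j with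
  | zero => rfl
  | succ j ih =>
    simp only [nestedCaps]
    rw [LinearMap.comp_assoc, ← ih, ← LinearMap.comp_assoc, ← LinearMap.comp_assoc,
      ← coF_midCap hq]
    rfl

lemma coF_multiplet (hq : q ≠ 0) (hn : ∀ n : ℕ, 0 < n → qInt q n ≠ 0) (m n j : ℕ) :
    coF q (m + j) (n + j) ∘ₗ multiplet q m n j = multiplet q m n j ∘ₗ opF q (m + n) := by
  rw [multiplet, ← LinearMap.comp_assoc, coF_nestedCaps hq, LinearMap.comp_assoc,
    coF_pairT_symTstar hq hn]
  rfl

lemma multiplet_vec_zero (hq : q ≠ 0) (hn : ∀ n : ℕ, 0 < n → qInt q n ≠ 0) (m n j : ℕ) :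
    multiplet q m n j (vec F (m + n) 0) = nestedCaps q m n j (vec F m 0 ⊗ₜ vec F n 0) := by
  have h : dvec q (m + n) 0 = vec F (m + n) 0 := by rw [dvec, gauss_zero_right hn, one_smul]
  rw [← h]
  simp only [multiplet, LinearMap.comp_apply]
  rw [symTstar_dvec hn, pairT_symVec hq hn]
  simp [dvec, gauss_zero_right hn]

lemma coord_coE (m n a b : ℕ) (x : VV F m n) :
    coord F m n a b (coE q m n x) = qInt q (a + 1) * coord F m n (a + 1) b x +
      q ^ ((m : ℤ) - 2 * a) * qInt q (b + 1) * coord F m n a (b + 1) x := by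
  have : coord F m n a b ∘ₗ coE q m n = qInt q (a + 1) • coord F m n (a + 1) b +
      (q ^ ((m : ℤ) - 2 * a) * qInt q (b + 1)) • coord F m n a (b + 1) :=
    hom_ext_vec_vec fun a' ha b' hb => by
      rw [LinearMap.comp_apply, coE_vec ha hb, map_add, map_smul, map_smul,
        coord_vec (by omega) hb, coord_vec ha (by omega), LinearMap.add_apply,
        LinearMap.smul_apply, LinearMap.smul_apply, coord_vec ha hb, coord_vec ha hb]
      congr 1
      · rcases a' with _ | a'
        · simp
        · by_cases h : a' = a ∧ b' = b
          · obtain ⟨rfl, rfl⟩ := h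
            simp
          · simp [h]
      · rcases b' with _ | b'
        · simp
        · by_cases h : a' = a ∧ b' = b
          · obtain ⟨rfl, rfl⟩ := h
            simp
          · simp [h]
  exact LinearMap.congr_fun this x

/-- A highest weight vector is determined by its coordinate at `v^m ⊗ v^(n - 2j)`. -/
lemma eq_zero_of_mem_highestWeightSpace (hn : ∀ n : ℕ, 0 < n → qInt q n ≠ 0) {m n j : ℕ}
    {x : VV F m n} (hx : x ∈ highestWeightSpace q m n j) (h0 : coord F m n 0 j x = 0) : x = 0 := by
  obtain ⟨hE, hw⟩ := hx
  have hE : coE q m n x = 0 := hE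
  have h : ∀ a b, coord F m n a b x = 0 := by
    intro a
    induction a with
    | zero =>
      intro b
      by_cases hb : b = j
      · rw [hb, h0]
      · exact coord_of_mem_weightSpace (by omega) hw
    | succ a ih =>
      intro b
      have := coord_coE (q := q) m n a b x
      rw [hE, map_zero, ih, mul_zero, add_zero] at this
      exact (mul_eq_zero.1 this.symm).resolve_left (hn _ a.succ_pos)
  exact eq_zero_of_coord h

lemma nestedCaps_mem_highestWeightSpace (hq : q ≠ 0) (m n j : ℕ) :
    nestedCaps q m n j (vec F m 0 ⊗ₜ vec F n 0) ∈ highestWeightSpace q (m + j) (n + j) j := by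
  refine ⟨?_, ?_⟩
  · change coE q (m + j) (n + j) _ = 0
    have := LinearMap.congr_fun (coE_nestedCaps hq m n j) (vec F m 0 ⊗ₜ vec F n 0)
    simp only [LinearMap.comp_apply] at this
    rw [this, coE_vec (Nat.zero_le _) (Nat.zero_le _)]
    simp
  · have := nestedCaps_mem_weightSpace (q := q)
      (vec_mem_weightSpace (F := F) (m := m) (n := n) (a := 0) (b := 0) rfl) j
    rwa [zero_add, zero_add] at this

lemma coord_nestedCaps_vec_zero (m n j : ℕ) :
    coord F (m + j) (n + j) 0 j (nestedCaps q m n j (vec F m 0 ⊗ₜ vec F n 0)) = (-q⁻¹) ^ j := by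
  have := coord_nestedCaps_zero_left (q := q) m n j 0 (vec F m 0 ⊗ₜ vec F n 0)
  rwa [zero_add, coord_vec (Nat.zero_le _) (Nat.zero_le _), if_pos ⟨rfl, rfl⟩, mul_one] at this

lemma highestWeightSpace_eq_span (hq : q ≠ 0) (hn : ∀ n : ℕ, 0 < n → qInt q n ≠ 0) (m n j : ℕ) :
    highestWeightSpace q (m + j) (n + j) j =
      Submodule.span F {nestedCaps q m n j (vec F m 0 ⊗ₜ vec F n 0)} := by
  refine le_antisymm (fun x hx => ?_) ?_
  · have hb := nestedCaps_mem_highestWeightSpace hq m n j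
    have hc := coord_nestedCaps_vec_zero (q := q) m n j
    have h0 : (-q⁻¹) ^ j ≠ 0 := pow_ne_zero _ (neg_ne_zero.2 (inv_ne_zero hq))
    generalize nestedCaps q m n j (vec F m 0 ⊗ₜ vec F n 0) = b at hb hc
    have h := eq_zero_of_mem_highestWeightSpace hn
      (sub_mem hx (Submodule.smul_mem _ (coord F _ _ 0 j x / (-q⁻¹) ^ j) hb))
      (by rw [map_sub, map_smul, hc, smul_eq_mul, div_mul_cancel₀ _ h0, sub_self])
    rw [sub_eq_zero.1 h]
    exact Submodule.smul_mem _ _ (Submodule.mem_span_singleton_self b)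
  · rw [Submodule.span_singleton_le_iff_mem]
    exact nestedCaps_mem_highestWeightSpace hq m n j

/-- `F` generates `V(n)` from its highest weight vector. -/
lemma opF_pow_vec_zero (n i : ℕ) (hi : i ≤ n) (hn : ∀ n : ℕ, 0 < n → qInt q n ≠ 0) :
    ∃ c : F, c ≠ 0 ∧ (opF q n ^ i) (vec F n 0) = c • vec F n i := by
  induction i with
  | zero => exact ⟨1, one_ne_zero, by simp⟩
  | succ i ih =>
    obtain ⟨c, hc, h⟩ := ih (by omega)
    refine ⟨c * qInt q (n - i), mul_ne_zero hc (hn _ (by omega)), ?_⟩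
    rw [pow_succ', Module.End.mul_apply, h, map_smul, opF, onBasis_vec _ (by omega), smul_smul]

/-- The sector of total spin deviation `j` is the image of the multiplet. -/
lemma spinSector_eq_range (hq : q ≠ 0) (hn : ∀ n : ℕ, 0 < n → qInt q n ≠ 0) (m n j : ℕ) :
    spinSector q (m + j) (n + j) j = LinearMap.range (multiplet q m n j) := by
  have hF : ∀ (i : ℕ) (x : V F (m + n)), (coF q (m + j) (n + j) ^ i) (multiplet q m n j x) =
      multiplet q m n j ((opF q (m + n) ^ i) x) := by
    intro i
    induction i with
    | zero => simp
    | succ i ih =>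
      intro x
      rw [pow_succ, Module.End.mul_apply, pow_succ, Module.End.mul_apply, ← ih]
      exact congrArg _ (LinearMap.congr_fun (coF_multiplet hq hn m n j) x)
  have hb := multiplet_vec_zero (F := F) hq hn m n j
  refine le_antisymm ?_ ?_
  · refine Submodule.span_le.2 ?_
    rintro _ ⟨i, w, hw, rfl⟩
    rw [highestWeightSpace_eq_span hq hn, Submodule.mem_span_singleton] at hw
    obtain ⟨c, rfl⟩ := hw
    rw [← hb, map_smul, hF, ← map_smul]
    exact LinearMap.mem_range_self _ _
  · rintro _ ⟨x, rfl⟩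
    have hv : ∀ i ≤ m + n, multiplet q m n j (vec F (m + n) i) ∈
        spinSector q (m + j) (n + j) j := by
      intro i hi
      obtain ⟨c, hc, h⟩ := opF_pow_vec_zero (F := F) (m + n) i hi hn
      have h1 := hF i (vec F (m + n) 0)
      rw [h, map_smul, hb] at h1
      rw [← inv_smul_smul₀ hc (multiplet q m n j (vec F (m + n) i)), ← h1]
      exact Submodule.smul_mem _ _ (Submodule.subset_span
        ⟨i, _, nestedCaps_mem_highestWeightSpace hq m n j, rfl⟩)
    have hx : (Submodule.mkQ (spinSector q (m + j) (n + j) j)) ∘ₗ multiplet q m n j = 0 :=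
      hom_ext_vec fun i hi => by simpa using hv i hi
    have := LinearMap.congr_fun hx x
    simpa using this

end Equivariance

/-! ### The eigenvalues -/

section Eigenvalues

variable {F : Type*} [Field F] {q : F}

lemma cascadeEigenvalue_eq_zero_iff (hn : ∀ n : ℕ, 0 < n → qInt q n ≠ 0) (n₁ n₂ k j : ℕ) :
    cascadeEigenvalue q n₁ n₂ k j = 0 ↔ n₂ < j + k := by
  rw [cascadeEigenvalue]
  split_ifs with h
  · have := fun n => qFact_ne_zero hn n
    simp [this, h]
  · simpa using h

lemma ncard_cascadeEigenvalue_eq_zero (hn : ∀ n : ℕ, 0 < n → qInt q n ≠ 0) {n₁ n₂ k : ℕ}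
    (hk : k ≤ n₂) : {j : ℕ | j ≤ n₂ ∧ cascadeEigenvalue q n₁ n₂ k j = 0}.ncard = k := by
  have : {j : ℕ | j ≤ n₂ ∧ cascadeEigenvalue q n₁ n₂ k j = 0} =
      (Finset.Ioc (n₂ - k) n₂ : Finset ℕ) := by
    ext j
    simp only [Set.mem_ofPred_eq, cascadeEigenvalue_eq_zero_iff hn, Finset.coe_Ioc, Set.mem_Ioc]
    omega
  rw [this, Set.ncard_coe_finset, Nat.card_Ioc]
  omega

lemma qInt_pos {t : ℝ} (ht : 0 < t) {n : ℕ} (hn : 0 < n) : 0 < qInt t n :=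
  Finset.sum_pos (fun _ _ => zpow_pos ht _) ⟨0, Finset.mem_range.2 hn⟩

lemma qInt_nonneg {t : ℝ} (ht : 0 < t) (n : ℕ) : 0 ≤ qInt t n :=
  Finset.sum_nonneg fun _ _ => (zpow_pos ht _).le

lemma qInt_monotone {t : ℝ} (ht : 0 < t) : Monotone (qInt t) := by
  refine monotone_nat_of_le_succ fun n => ?_
  rcases le_total 1 t with h | h
  · have h1 : qInt t (n + 1) = t * qInt t n + (t ^ n)⁻¹ := by simpa using qInt_add ht.ne' n 1
    rw [h1]
    have := mul_le_mul_of_nonneg_right h (qInt_nonneg ht n)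
    have : 0 < (t ^ n)⁻¹ := by positivity
    linarith
  · have h1 : qInt t (n + 1) = t⁻¹ * qInt t n + t ^ n := by simpa using qInt_add' ht.ne' n 1
    rw [h1]
    have := mul_le_mul_of_nonneg_right ((one_le_inv₀ ht).2 h) (qInt_nonneg ht n)
    have : 0 < t ^ n := by positivity
    linarith

lemma qFact_pos {t : ℝ} (ht : 0 < t) (n : ℕ) : 0 < qFact t n :=
  Finset.prod_pos fun i _ => qInt_pos ht i.succ_pos

lemma cascadeEigenvalue_nonneg {t : ℝ} (ht : 0 < t) (n₁ n₂ k j : ℕ) :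
    0 ≤ cascadeEigenvalue t n₁ n₂ k j := by
  have := fun n => qFact_pos ht n
  rw [cascadeEigenvalue]
  split_ifs
  · exact (div_pos (mul_pos (mul_pos (mul_pos (this _) (this _)) (this _)) (this _))
      (mul_pos (mul_pos (mul_pos (this _) (this _)) (this _)) (this _))).le
  · exact le_rfl

/-- The ratio of consecutive eigenvalues is `[n₁ - j][n₂ - j - k] / ([n₁ + k - j][n₂ - j])`. -/
lemma cascadeEigenvalue_succ_le {t : ℝ} (ht : 0 < t) {n₁ n₂ k j : ℕ} (hj : j + 1 ≤ n₁) :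
    cascadeEigenvalue t n₁ n₂ k (j + 1) ≤ cascadeEigenvalue t n₁ n₂ k j := by
  by_cases h : j + 1 + k ≤ n₂
  · obtain ⟨a, rfl⟩ := Nat.exists_eq_add_of_le hj
    obtain ⟨b, rfl⟩ := Nat.exists_eq_add_of_le h
    rw [cascadeEigenvalue, cascadeEigenvalue, if_pos h, if_pos (by omega),
      show j + 1 + a + k - (j + 1) = a + k by omega, show j + 1 + a + k - j = a + k + 1 by omega,
      show j + 1 + k + b - (j + 1) = b + k by omega, show j + 1 + k + b - j = b + k + 1 by omega,
      show j + 1 + a - (j + 1) = a by omega, show j + 1 + a - j = a + 1 by omega,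
      show b + k - k = b by omega, show b + k + 1 - k = b + 1 by omega,
      qFact_succ (a + k), qFact_succ (b + k), qFact_succ a, qFact_succ b]
    have hp := fun n => qFact_pos ht n
    have hi := fun n => qInt_pos ht (Nat.succ_pos n)
    have h1 : qInt t (a + 1) ≤ qInt t (a + k + 1) := qInt_monotone ht (by omega)
    have h2 : qInt t (b + 1) ≤ qInt t (b + k + 1) := qInt_monotone ht (by omega)
    have h3 := mul_le_mul h1 h2 (hi b).le (hi (a + k)).le
    have e1 := hp (a + k)
    have e2 := hp (b + k)
    have e3 := hp a
    have e4 := hp b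
    have e5 := hp (j + 1 + a)
    have e6 := hp (j + 1 + k + b - k)
    have e7 := hp (j + 1 + a + k)
    have e8 := hp (j + 1 + k + b)
    have e9 := hi a
    have e10 := hi b
    rw [div_le_div_iff₀ (by positivity) (by positivity)]
    generalize qInt t (a + k + 1) = x at *
    generalize qInt t (b + k + 1) = y at *
    calc _ = (qFact t (a + k) * qFact t (j + 1 + a) * qFact t (b + k) *
          qFact t (j + 1 + k + b - k) * qFact t a * qFact t (j + 1 + a + k) * qFact t b *
          qFact t (j + 1 + k + b)) * (qInt t (a + 1) * qInt t (b + 1)) := by ring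
      _ ≤ (qFact t (a + k) * qFact t (j + 1 + a) * qFact t (b + k) *
          qFact t (j + 1 + k + b - k) * qFact t a * qFact t (j + 1 + a + k) * qFact t b *
          qFact t (j + 1 + k + b)) * (x * y) := by gcongr
      _ = _ := by ring
  · rw [cascadeEigenvalue, if_neg h]
    exact cascadeEigenvalue_nonneg ht _ _ _ _

lemma cascadeEigenvalue_antitone {t : ℝ} (ht : 0 < t) (n₁ n₂ k : ℕ) {i j : ℕ} (hij : i ≤ j)
    (hj : j ≤ n₁) : cascadeEigenvalue t n₁ n₂ k j ≤ cascadeEigenvalue t n₁ n₂ k i := by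
  induction j, hij using Nat.le_induction with
  | base => exact le_rfl
  | succ j _ ih => exact (cascadeEigenvalue_succ_le ht hj).trans (ih (by omega))

end Eigenvalues

/-! ### Independent subspaces and eigenvalues -/

section LinearAlgebra

variable {F M ι : Type*} [Field F] [AddCommGroup M] [Module F M] [Fintype ι]

/-- Subspaces are independent if, for each index, some operator is a scalar on each of them, the
scalar being non-zero at this index and zero at the later ones. -/
lemma eq_zero_of_sum_eq_zero [LinearOrder ι] {S : ι → Submodule F M} {K : ι → M →ₗ[F] M}
    {c : ι → ι → F} (hK : ∀ i j, ∀ x ∈ S j, K i x = c i j • x) (hc : ∀ i j, i < j → c i j = 0)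
    (hd : ∀ i, c i i ≠ 0) {z : ι → M} (hz : ∀ j, z j ∈ S j) (h : ∑ j, z j = 0) (j : ι) :
    z j = 0 := by
  induction j using WellFoundedLT.induction with
  | ind j ih =>
    have h1 := congrArg (K j) h
    rw [map_sum, map_zero, Finset.sum_eq_single j, hK j j _ (hz j)] at h1
    · exact (smul_eq_zero.1 h1).resolve_left (hd j)
    · intro i _ hij
      rcases lt_or_gt_of_ne hij with h2 | h2
      · rw [ih i h2, map_zero]
      · rw [hK j i _ (hz i), hc j i h2, zero_smul]
    · simp

lemma isInternal_of_sum_finrank [DecidableEq ι] [FiniteDimensional F M] {S : ι → Submodule F M}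
    (hS : ∀ z : ι → M, (∀ j, z j ∈ S j) → ∑ j, z j = 0 → ∀ j, z j = 0)
    (hd : ∑ j, Module.finrank F (S j) = Module.finrank F M) : DirectSum.IsInternal S := by
  classical
  have hinj : Function.Injective (DirectSum.coeLinearMap S) := by
    rw [injective_iff_map_eq_zero]
    intro y hy
    rw [DirectSum.coeLinearMap_eq_dfinsuppSum, DFinsupp.sum_eq_sum_fintype _ (by simp)] at hy
    exact DFinsupp.ext fun j => Subtype.ext (hS (fun j => y j) (fun j => (y j).2) hy j)
  have hdim : Module.finrank F (DirectSum ι fun j => S j) = Module.finrank F M := by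
    rw [Module.finrank_directSum, hd]
  exact ⟨hinj, (LinearMap.injective_iff_surjective_of_finrank_eq_finrank hdim).1 hinj⟩

lemma exists_eq_of_hasEigenvalue [DecidableEq ι] {S : ι → Submodule F M}
    (hS : DirectSum.IsInternal S) {K : M →ₗ[F] M} {c : ι → F}
    (hK : ∀ j, ∀ x ∈ S j, K x = c j • x) {μ : F} (h : Module.End.HasEigenvalue K μ) :
    ∃ j, μ = c j := by
  classical
  obtain ⟨x, hx⟩ := h.exists_hasEigenvector
  have hx0 := hx.2
  have hKx : K x = μ • x := hx.apply_eq_smul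
  obtain ⟨y, rfl⟩ := hS.2 x
  by_contra! hne
  -- the components of the eigenvector, each multiplied by the non-zero number `c j - μ`
  let z : DirectSum ι fun j => S j := DFinsupp.mapRange (fun j v => (c j - μ) • v) (by simp) y
  have hz : z = 0 := by
    refine hS.1 ?_
    rw [map_zero]
    rw [DirectSum.coeAddMonoidHom_eq_dfinsuppSum, DFinsupp.sum_eq_sum_fintype _ (by simp)] at hKx ⊢
    rw [map_sum, Finset.smul_sum] at hKx
    simp only [z, DFinsupp.mapRange_apply, sub_smul, AddSubgroupClass.coe_sub,
      Submodule.coe_smul, Finset.sum_sub_distrib, DFinsupp.equivFunOnFintype_apply]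
    rw [sub_eq_zero]
    refine Eq.trans ?_ hKx
    exact Finset.sum_congr rfl fun j _ => (hK j _ (y j).2).symm
  refine hx0 ?_
  have hy : y = 0 := DFinsupp.ext fun j => by
    have : (c j - μ) • y j = 0 := congrArg (fun v => v j) hz
    exact (smul_eq_zero.1 this).resolve_left (sub_ne_zero.2 (hne j).symm)
  rw [hy, map_zero]

end LinearAlgebra

/-! ### The sectors and the dual canonical basis -/

section Decomposition

variable {F : Type*} [Field F] {q : F}

lemma exists_add_of_le_min {n₁ n₂ j : ℕ} (hj : j ≤ min n₁ n₂) :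
    ∃ m n, n₁ = m + j ∧ n₂ = n + j :=
  ⟨n₁ - j, n₂ - j, by omega, by omega⟩

lemma cascade_of_mem_spinSector (hq : q ≠ 0) (hn : ∀ n : ℕ, 0 < n → qInt q n ≠ 0) {n₁ n₂ k j : ℕ}
    (hk : k ≤ n₂) (hj : j ≤ min n₁ n₂) {x : VV F n₁ n₂} (hx : x ∈ spinSector q n₁ n₂ j) :
    cascade q n₁ n₂ k hk x = cascadeEigenvalue q n₁ n₂ k j • x := by
  obtain ⟨m, n, rfl, rfl⟩ := exists_add_of_le_min hj
  rw [spinSector_eq_range hq hn] at hx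
  obtain ⟨y, rfl⟩ := hx
  exact LinearMap.congr_fun (cascade_multiplet hq hn m n j k hk) y

/-- The sectors are independent: the operator with `k = n₂ - j` kills the sectors after the `j`-th
one, but not the `j`-th one itself. -/
lemma eq_zero_of_sum_spinSector (hq : q ≠ 0) (hn : ∀ n : ℕ, 0 < n → qInt q n ≠ 0) {n₁ n₂ : ℕ}
    (z : Fin (min n₁ n₂ + 1) → VV F n₁ n₂)
    (hz : ∀ j : Fin (min n₁ n₂ + 1), z j ∈ spinSector q n₁ n₂ j) (h : ∑ j, z j = 0)
    (j : Fin (min n₁ n₂ + 1)) : z j = 0 :=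
  eq_zero_of_sum_eq_zero (S := fun j : Fin (min n₁ n₂ + 1) => spinSector q n₁ n₂ (j : ℕ))
    (K := fun i => cascade q n₁ n₂ (n₂ - i) (Nat.sub_le _ _))
    (c := fun i j => cascadeEigenvalue q n₁ n₂ (n₂ - i) j)
    (fun _ j _ hx => cascade_of_mem_spinSector hq hn _ (Nat.le_of_lt_succ j.2) hx)
    (fun i j hij => (cascadeEigenvalue_eq_zero_iff hn _ _ _ _).2 (by omega))
    (fun i => mt (cascadeEigenvalue_eq_zero_iff hn _ _ _ _).1 (by omega)) hz h j

lemma finrank_spinSector (hq : q ≠ 0) (hn : ∀ n : ℕ, 0 < n → qInt q n ≠ 0) {n₁ n₂ j : ℕ}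
    (hj : j ≤ min n₁ n₂) :
    Module.finrank F (spinSector q n₁ n₂ j) = n₁ + n₂ - 2 * j + 1 := by
  obtain ⟨m, n, rfl, rfl⟩ := exists_add_of_le_min hj
  rw [spinSector_eq_range hq hn, LinearMap.finrank_range_of_inj (multiplet_injective hq hn m n j),
    Module.finrank_fin_fun]
  omega

/-- The sum of the dimensions of the first `s` sectors. -/
lemma sum_range_add_sub_two_mul (n₁ n₂ s : ℕ) (hs : s ≤ min n₁ n₂ + 1) :
    ∑ j ∈ Finset.range s, (n₁ + n₂ - 2 * j + 1) = s * (n₁ + n₂ + 2 - s) := by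
  induction s with
  | zero => simp
  | succ s ih =>
    rw [Finset.sum_range_succ, ih (by omega)]
    obtain ⟨c, hc⟩ : ∃ c, n₁ + n₂ = 2 * s + c := ⟨n₁ + n₂ - 2 * s, by omega⟩
    rw [hc, show 2 * s + c + 2 - s = s + c + 2 by omega,
      show 2 * s + c + 2 - (s + 1) = s + c + 1 by omega, show 2 * s + c - 2 * s = c by omega]
    ring

lemma isInternal_spinSector (hq : q ≠ 0) (hn : ∀ n : ℕ, 0 < n → qInt q n ≠ 0) (n₁ n₂ : ℕ) :
    DirectSum.IsInternal
      (fun j : Fin (min n₁ n₂ + 1) => spinSector q n₁ n₂ (j : ℕ)) := by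
  refine isInternal_of_sum_finrank (eq_zero_of_sum_spinSector hq hn) ?_
  rw [Module.finrank_tensorProduct, Module.finrank_fin_fun, Module.finrank_fin_fun,
    Finset.sum_congr rfl fun j _ => finrank_spinSector hq hn (Nat.le_of_lt_succ j.2),
    Fin.sum_univ_eq_sum_range (fun j => n₁ + n₂ - 2 * j + 1),
    sum_range_add_sub_two_mul _ _ _ le_rfl]
  rcases le_total n₁ n₂ with h | h
  · rw [min_eq_left h, show n₁ + n₂ + 2 - (n₁ + 1) = n₂ + 1 by omega]
  · rw [min_eq_right h, show n₁ + n₂ + 2 - (n₂ + 1) = n₁ + 1 by omega, mul_comm]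

lemma nestedCaps_vec_zero_ne_zero (hq : q ≠ 0) (m n j : ℕ) :
    nestedCaps q m n j (vec F m 0 ⊗ₜ vec F n 0) ≠ 0 := fun h => by
  have := coord_nestedCaps_vec_zero (q := q) m n j
  rw [h, map_zero] at this
  exact pow_ne_zero j (neg_ne_zero.2 (inv_ne_zero hq)) this.symm

lemma hasEigenvalue_cascade_iff (hq : q ≠ 0) (hn : ∀ n : ℕ, 0 < n → qInt q n ≠ 0) {n₁ n₂ k : ℕ}
    (hk : k ≤ n₂) (μ : F) : Module.End.HasEigenvalue (cascade q n₁ n₂ k hk) μ ↔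
      ∃ j ≤ min n₁ n₂, μ = cascadeEigenvalue q n₁ n₂ k j := by
  constructor
  · intro h
    obtain ⟨j, hj⟩ := exists_eq_of_hasEigenvalue (isInternal_spinSector hq hn n₁ n₂)
      (c := fun j => cascadeEigenvalue q n₁ n₂ k j)
      (fun j _ hx => cascade_of_mem_spinSector hq hn hk (Nat.le_of_lt_succ j.2) hx) h
    exact ⟨j, Nat.le_of_lt_succ j.2, hj⟩
  · rintro ⟨j, hj, rfl⟩
    obtain ⟨m, n, rfl, rfl⟩ := exists_add_of_le_min hj
    have hb : multiplet q m n j (vec F (m + n) 0) ∈ spinSector q (m + j) (n + j) j := by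
      rw [spinSector_eq_range hq hn]
      exact LinearMap.mem_range_self _ _
    refine Module.End.hasEigenvalue_of_hasEigenvector
      ⟨Module.End.mem_eigenspace_iff.2 (cascade_of_mem_spinSector hq hn hk hj hb), ?_⟩
    rw [multiplet_vec_zero hq hn]
    exact nestedCaps_vec_zero_ne_zero hq m n j

lemma coord_nestedCaps_vec_zero_right (hq : q ≠ 0) (m n j : ℕ) :
    coord F (m + j) (n + j) j 0 (nestedCaps q m n j (vec F m 0 ⊗ₜ vec F n 0)) ≠ 0 := by
  obtain ⟨c, hc, h⟩ := coord_nestedCaps_zero_right (F := F) hq m n j 0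
  rw [zero_add] at h
  rwa [h, coord_vec (Nat.zero_le _) (Nat.zero_le _), if_pos ⟨rfl, rfl⟩, mul_one]

/-- A down arrow in the left block of the through lines kills the coordinate without down arrows on
the left, and a down arrow in the right block the coordinate without down arrows on the right. -/
lemma IsCapDiagram.coord_pairT (hq : q ≠ 0) {r k m n L : ℕ} {d : Tens F r →ₗ[F] Tens F L}
    (hd : IsCapDiagram q r k L d) (h : m + n = L) (w : Fin r → Fin 2)
    (h0 : pairT q h (d (tensBasis F r w)) ≠ 0) :
    pairT q h (d (tensBasis F r w)) ∈ weightSpace F m n (downs w + k) ∧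
      (downs w ≠ 0 → coord F m n 0 (downs w + k) (pairT q h (d (tensBasis F r w))) = 0 ∨
        coord F m n (downs w + k) 0 (pairT q h (d (tensBasis F r w))) = 0) := by
  have hL := hd.length
  have hk : k ≤ m ∧ k ≤ n := by
    by_contra hc
    exact h0 (LinearMap.congr_fun (hd.pairT_eq_zero hq h (by omega)) _)
  obtain ⟨m, rfl⟩ := Nat.exists_eq_add_of_le' hk.1
  obtain ⟨n, rfl⟩ := Nat.exists_eq_add_of_le' hk.2
  have h' : m + n = r := by omega
  rcases hd.pairT_eq hq h h' with e | e
  · exact absurd (LinearMap.congr_fun e _) h0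
  have e := LinearMap.congr_fun e (tensBasis F r w)
  obtain ⟨c, a, b, ha, hb, hab, hw⟩ := pairT_tensBasis (q := q) h' w
  rw [LinearMap.comp_apply, LinearMap.comp_apply, hw, map_smul] at e
  rw [e]
  refine ⟨Submodule.smul_mem _ _ (nestedCaps_mem_weightSpace (vec_mem_weightSpace hab) k),
    fun hne => ?_⟩
  rw [map_smul, map_smul]
  by_cases ha0 : a = 0
  · right
    obtain ⟨c', -, hc'⟩ := coord_nestedCaps_zero_right (F := F) hq m n k (downs w)
    rw [hc', coord_vec ha hb, if_neg (by omega), mul_zero, smul_zero]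
  · left
    rw [coord_nestedCaps_zero_left, coord_vec ha hb, if_neg (by omega), mul_zero, smul_zero]

/-- Up to scalars there is one highest weight vector, and neither of its two extreme coordinates is
zero. So a dual canonical basis vector in the highest weight space has no down arrow on its through
lines. -/
lemma dualCanonicalBasis_inter_highestWeightSpace (hq : q ≠ 0)
    (hn : ∀ n : ℕ, 0 < n → qInt q n ≠ 0) (m n j : ℕ) :
    dualCanonicalBasis q (m + j) (n + j) ∩ highestWeightSpace q (m + j) (n + j) j =
      {nestedCaps q m n j (vec F m 0 ⊗ₜ vec F n 0)} := by
  have hb0 := nestedCaps_vec_zero_ne_zero hq m n j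
  refine Set.Subset.antisymm ?_ (Set.singleton_subset_iff.2 ⟨⟨hb0, ?_⟩,
    nestedCaps_mem_highestWeightSpace hq m n j⟩)
  · rintro x ⟨⟨hx0, r, k, a, d, ha, hd, rfl⟩, hx⟩
    have hL := hd.length
    generalize sortedWord r a = w at *
    obtain ⟨hw, hc⟩ := hd.coord_pairT hq rfl w hx0
    rw [SetLike.mem_coe, highestWeightSpace_eq_span hq hn, Submodule.mem_span_singleton] at hx
    obtain ⟨c, hx⟩ := hx
    have hc0 : c ≠ 0 := by
      rintro rfl
      exact hx0 (by rw [← hx, zero_smul])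
    have hl : coord F (m + j) (n + j) 0 j (pairT q rfl (d (tensBasis F r w))) ≠ 0 := by
      rw [← hx, map_smul, coord_nestedCaps_vec_zero]
      exact smul_ne_zero hc0 (pow_ne_zero j (neg_ne_zero.2 (inv_ne_zero hq)))
    have hr : coord F (m + j) (n + j) j 0 (pairT q rfl (d (tensBasis F r w))) ≠ 0 := by
      rw [← hx, map_smul]
      exact smul_ne_zero hc0 (coord_nestedCaps_vec_zero_right hq m n j)
    have hj : downs w + k = j := by
      by_contra hne
      exact hl (coord_of_mem_weightSpace (by omega) hw)
    rw [hj] at hc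
    have hd0 : downs w = 0 := by
      by_contra hne
      exact (hc hne).elim hl hr
    obtain rfl : k = j := by omega
    have h' : m + n = r := by omega
    rcases hd.pairT_eq hq rfl h' with e | e
    · exact absurd (LinearMap.congr_fun e _) hx0
    have e := LinearMap.congr_fun e (tensBasis F r w)
    simp only [LinearMap.comp_apply] at e
    rw [Set.mem_singleton_iff, e, eq_zero_of_downs hd0, pairT_tensBasis_zero]
  · obtain ⟨L, h, d, hd, e⟩ := exists_isCapDiagram_nestedCaps (q := q) m n j
    subst h
    refine ⟨m + n, j, 0, d, Nat.zero_le _, hd, ?_⟩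
    have hs : sortedWord (m + n) 0 = fun _ => 0 := rfl
    have := LinearMap.congr_fun e (tensBasis F (m + n) (sortedWord (m + n) 0))
    simp only [LinearMap.comp_apply] at this
    rw [this, hs, pairT_tensBasis_zero]

lemma cascade_cap_diagram (hq : q ≠ 0) (hn : ∀ n : ℕ, 0 < n → qInt q n ≠ 0) {n₁ n₂ k j r : ℕ}
    (hk : k ≤ n₂) (hj : j ≤ min n₁ n₂) {d : Tens F r →ₗ[F] Tens F (n₁ + n₂)}
    (hd : IsCapDiagram q r j (n₁ + n₂) d) :
    cascade q n₁ n₂ k hk ∘ₗ (pairT q rfl ∘ₗ d ∘ₗ symTstar q r) =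
      cascadeEigenvalue q n₁ n₂ k j • (pairT q rfl ∘ₗ d ∘ₗ symTstar q r) := by
  obtain ⟨m, n, rfl, rfl⟩ := exists_add_of_le_min hj
  have hL := hd.length
  obtain rfl : r = m + n := by omega
  rw [← LinearMap.comp_assoc (symTstar q (m + n))]
  rcases hd.pairT_eq hq rfl rfl with e | e
  · rw [e, LinearMap.zero_comp, LinearMap.comp_zero, smul_zero]
  · rw [e]
    exact cascade_multiplet hq hn m n j k hk

end Decomposition

end CascadeSpin

end

theorem mainTheorem9 (n₁ n₂ k : ℕ) (hk : k ≤ n₂) :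
    (∀ (F : Type*) [Field F] (q : F), q ≠ 0 → (∀ n : ℕ, 0 < n → CascadeSpin.qInt q n ≠ 0) →
      -- the dual canonical highest weight vectors are a basis of highest weight vectors, one for
      -- each `j`, in which the operator is diagonal
      (∀ j ≤ min n₁ n₂, ∃ b : CascadeSpin.VV F n₁ n₂, b ≠ 0 ∧
        CascadeSpin.dualCanonicalBasis q n₁ n₂ ∩ CascadeSpin.highestWeightSpace q n₁ n₂ j = {b} ∧
        CascadeSpin.highestWeightSpace q n₁ n₂ j = Submodule.span F {b} ∧
        CascadeSpin.cascade q n₁ n₂ k hk b = CascadeSpin.cascadeEigenvalue q n₁ n₂ k j • b) ∧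
      -- the same for the whole multiplets: cap diagrams below a symmetrizer of all through lines
      (∀ j ≤ min n₁ n₂, ∀ (r : ℕ)
        (d : CascadeSpin.Tens F r →ₗ[F] CascadeSpin.Tens F (n₁ + n₂)),
        CascadeSpin.IsCapDiagram q r j (n₁ + n₂) d →
        CascadeSpin.cascade q n₁ n₂ k hk ∘ₗ
            (CascadeSpin.pairT q rfl ∘ₗ d ∘ₗ CascadeSpin.symTstar q r) =
          CascadeSpin.cascadeEigenvalue q n₁ n₂ k j •
            (CascadeSpin.pairT q rfl ∘ₗ d ∘ₗ CascadeSpin.symTstar q r)) ∧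
      -- the whole space is the direct sum of the sectors, and the operator is a scalar on each
      DirectSum.IsInternal
        (fun j : Fin (min n₁ n₂ + 1) => CascadeSpin.spinSector q n₁ n₂ (j : ℕ)) ∧
      (∀ j ≤ min n₁ n₂, ∀ x ∈ CascadeSpin.spinSector q n₁ n₂ j,
        CascadeSpin.cascade q n₁ n₂ k hk x = CascadeSpin.cascadeEigenvalue q n₁ n₂ k j • x) ∧
      (∀ μ : F, Module.End.HasEigenvalue (CascadeSpin.cascade q n₁ n₂ k hk) μ ↔
        ∃ j ≤ min n₁ n₂, μ = CascadeSpin.cascadeEigenvalue q n₁ n₂ k j) ∧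
      -- the degeneracy at zero, counted in sectors
      (n₂ ≤ n₁ → {j : ℕ | j ≤ n₂ ∧ CascadeSpin.cascadeEigenvalue q n₁ n₂ k j = 0}.ncard = k)) ∧
    (∀ t : ℝ, 0 < t → ∀ i j : ℕ, i ≤ j → j ≤ min n₁ n₂ →
      CascadeSpin.cascadeEigenvalue t n₁ n₂ k j ≤ CascadeSpin.cascadeEigenvalue t n₁ n₂ k i) := by
  refine ⟨fun F _ q hq hn => ⟨fun j hj => ?_, fun j hj r d hd => ?_, ?_, fun j hj x hx => ?_,
    fun μ => ?_, fun _ => ?_⟩, fun t ht i j hij hj => ?_⟩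
  · obtain ⟨m, n, rfl, rfl⟩ := CascadeSpin.exists_add_of_le_min hj
    refine ⟨_, CascadeSpin.nestedCaps_vec_zero_ne_zero hq m n j,
      CascadeSpin.dualCanonicalBasis_inter_highestWeightSpace hq hn m n j,
      CascadeSpin.highestWeightSpace_eq_span hq hn m n j, ?_⟩
    rw [← CascadeSpin.multiplet_vec_zero hq hn]
    exact LinearMap.congr_fun (CascadeSpin.cascade_multiplet hq hn m n j k hk) _
  · exact CascadeSpin.cascade_cap_diagram hq hn hk hj hd
  · exact CascadeSpin.isInternal_spinSector hq hn n₁ n₂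
  · exact CascadeSpin.cascade_of_mem_spinSector hq hn hk hj hx
  · exact CascadeSpin.hasEigenvalue_cascade_iff hq hn hk μ
  · exact CascadeSpin.ncard_cascadeEigenvalue_eq_zero hn hk
  · exact CascadeSpin.cascadeEigenvalue_antitone ht n₁ n₂ k hij (by omega)
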